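/- Fix a dimension $d\ge 1$, and let $|x|=|x_1|+\dots+|x_d|$ for $x\in\mathbb Z^d$. A self-avoiding walk of length $N$ from $x$ to $y$ is a sequence $x_0=x,x_1,\dots,x_N=y$ of distinct points of $\mathbb Z^d$ with $|x_i-x_{i-1}|=1$ for $i=1,\dots,N$; let $\mathcal S_N(y,x)$ be the set of these walks, let $c_N$ be the number of self-avoiding walks of length $N$ that start at $0$, let $\mu_d=\lim_{N\to\infty}c_N^{1/N}$ be the connective constant, and let $$C_\gamma(v)=\sum_{N=0}^\infty\gamma^N\,\#\mathcal S_N(v,0)$$ be the self-avoiding-walk correlation function, defined where the series converges absolutely. Let $\omega(x)$, $x\in\mathbb Z^d$, be independent random variables, uniformly distributed in $[-1,1]$. For $\lambda>0$ and $\Lambda\subset\mathbb Z^d$ (finite or infinite) let $H_\omega^{(\Lambda)}$ be the operator on $\ell^2(\Lambda)$ given by $$H_\omega^{(\Lambda)}\psi(x)=\sum_{x'\in\Lambda,\ |x'-x|=1}\psi(x')+\lambda\,\omega(x)\psi(x),$$ and let $G_z^{(\Lambda)}(x,y)=\langle\delta_x,(H_\omega^{(\Lambda)}-z)^{-1}\delta_y\rangle$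 if $x,y\in\Lambda$, and $G_z^{(\Lambda)}(x,y)=0$ otherwise. Let $\gamma(\lambda)=\frac{e\ln\lambda}{\lambda}$. (1) If $\lambda>e$ and $\mu_d\,\gamma(\lambda)<1$, then the series $C_{\gamma(\lambda)}(v)$ converges for every $v\in\mathbb Z^d$, and for every subset $\Lambda\subset\mathbb Z^d$ and every $z\in\mathbb C\setminus[-2d-\lambda,2d+\lambda]$ the operator $H^{(\Lambda)}_\omega-z$ is invertible and $$\mathbb E\Big(\big|G_z^{(\Lambda)}(x,y)\big|^{1-\frac1{\ln\lambda}}\Big)\le(\ln\lambda)\,C_{\gamma(\lambda)}(x-y)\qquad\text{for all }x,y\in\mathbb Z^d.$$ (2) The equation $\lambda=\mu_d\,e\ln\lambda$ has exactly one solution $\lambda_{\mathrm{And}}$ in $[e,\infty)$. Let $\lambda>\lambda_{\mathrm{And}}$ and, for $\epsilon>0$, let $m_\epsilon(\lambda)=-\ln\gamma(\lambda)-\ln(\mu_d+\epsilon)$. Then $m_\epsilon(\lambda)>0$ for all sufficiently small $\epsilon>0$, and for every $\epsilon>0$ there is a constant $K_\epsilon<\infty$, depending only on $d$, $\lambda$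 and $\epsilon$, such that $$\mathbb E\Big(\big|G_z^{(\Lambda)}(x,y)\big|^{1-\frac1{\ln\lambda}}\Big)\le K_\epsilon\,(\ln\lambda)\,e^{-m_\epsilon(\lambda)\,|x-y|}$$ for every $\Lambda\subset\mathbb Z^d$, every $z\in\mathbb C\setminus[-2d-\lambda,2d+\lambda]$ and all $x,y\in\mathbb Z^d$. -/

import Mathlib

open MeasureTheory ProbabilityTheory Filter Topology

/-- The `ℓ¹` norm `|x| = |x₁| + ⋯ + |x_d|` of a lattice vector. -/
def latticeNorm {d : ℕ} (x : Fin d → ℤ) : ℕ := ∑ i, (x i).natAbs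

/-! ### Self-avoiding walks -/

/-- `w = (w 0, …, w N)` is a self-avoiding walk of length `N` in `ℤ^d`. -/
def IsSelfAvoidingWalk {d N : ℕ} (w : Fin (N + 1) → Fin d → ℤ) : Prop :=
  Function.Injective w ∧ ∀ i : Fin N, latticeNorm (w i.succ - w i.castSucc) = 1

/-- The set of self-avoiding walks of length `N` that start at `x` and end at `y`. -/
def sawBetween {d : ℕ} (N : ℕ) (y x : Fin d → ℤ) : Set (Fin (N + 1) → Fin d → ℤ) :=
  {w | IsSelfAvoidingWalk w ∧ w 0 = x ∧ w (Fin.last N) = y}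

/-- The set of self-avoiding walks of length `N` that start at the origin. -/
def sawFromZero (d N : ℕ) : Set (Fin (N + 1) → Fin d → ℤ) :=
  {w | IsSelfAvoidingWalk w ∧ w 0 = 0}

/-- The number `c_N` of self-avoiding walks of length `N` that start at the origin. -/
noncomputable def sawCount (d N : ℕ) : ℕ := (sawFromZero d N).ncard

/-- The connective constant `μ_d = lim c_N ^ (1 / N)`; see `tendsto_connectiveConstant`. -/
noncomputable def connectiveConstant (d : ℕ) : ℝ :=
  limUnder atTop (fun N : ℕ => (sawCount d N : ℝ) ^ (1 / (N : ℝ)))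

/-- The `N`-th term of the series that defines the correlation function at `v`. -/
noncomputable def sawCorrelationTerm {d : ℕ} (γ : ℝ) (v : Fin d → ℤ) (N : ℕ) : ℝ :=
  γ ^ N * ((sawBetween N v 0).ncard : ℝ)

/-- The self-avoiding walk correlation function `C_γ(v) = ∑_N γ^N #S_N(v, 0)`. -/
noncomputable def sawCorrelation {d : ℕ} (γ : ℝ) (v : Fin d → ℤ) : ℝ :=
  ∑' N, sawCorrelationTerm γ v N

/-! ### Existence of the limit that defines the connective constant -/

theorem latticeNorm_natAbs_le {d : ℕ} (x : Fin d → ℤ) (i : Fin d) :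
    (x i).natAbs ≤ latticeNorm x :=
  Finset.single_le_sum (f := fun i => (x i).natAbs) (fun _ _ => Nat.zero_le _) (Finset.mem_univ i)

theorem sawFromZero_finite (d N : ℕ) : (sawFromZero d N).Finite := by
  refine (Set.finite_Icc (fun _ _ => -(N : ℤ)) (fun _ _ => (N : ℤ))).subset ?_
  rintro w ⟨⟨-, hs⟩, h0⟩
  have key : ∀ i : Fin (N + 1), ∀ j, (w i j).natAbs ≤ (i : ℕ) := by
    intro i
    induction i using Fin.induction with
    | zero => intro j; simp [h0]
    | succ i ih =>
      intro j
      have h1 := latticeNorm_natAbs_le (w i.succ - w i.castSucc) j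
      rw [hs i] at h1
      have h2 := ih j
      simp only [Pi.sub_apply, Fin.val_succ, Fin.val_castSucc] at *
      omega
  constructor <;> intro i j <;> have h1 := key i j <;> have h2 := i.2 <;> simp only <;> omega

theorem sawCount_pos {d : ℕ} (hd : 1 ≤ d) (N : ℕ) : 1 ≤ sawCount d N := by
  refine (Set.ncard_pos (sawFromZero_finite d N)).2 ?_
  refine ⟨fun i => Pi.single ⟨0, hd⟩ ((i : ℕ) : ℤ), ⟨?_, ?_⟩, ?_⟩
  · intro i j h
    have := congrFun h ⟨0, hd⟩
    simp only [Pi.single_eq_same, Nat.cast_inj] at this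
    exact Fin.ext this
  · intro i
    simp only [latticeNorm]
    rw [Finset.sum_eq_single ⟨0, hd⟩]
    · simp
    · intro b _ hb
      simp [hb]
    · simp
  · simp

theorem sawCount_add_le (d m n : ℕ) : sawCount d (m + n) ≤ sawCount d m * sawCount d n := by
  unfold sawCount
  rw [← Set.ncard_prod]
  refine Set.ncard_le_ncard_of_injOn
    (fun w => (fun i : Fin (m + 1) => w ⟨i, by omega⟩,
      fun i : Fin (n + 1) => w ⟨m + i, by omega⟩ - w ⟨m, by omega⟩)) ?_ ?_
    ((sawFromZero_finite d m).prod (sawFromZero_finite d n))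
  · rintro w ⟨⟨hi, hs⟩, h0⟩
    refine ⟨⟨⟨?_, ?_⟩, ?_⟩, ⟨⟨?_, ?_⟩, ?_⟩⟩
    · intro i j h
      have := hi h
      simp only [Fin.mk.injEq] at this
      exact Fin.ext this
    · intro i
      exact hs ⟨i, by omega⟩
    · exact h0
    · intro i j h
      have := hi (sub_left_injective h)
      simp only [Fin.mk.injEq] at this
      exact Fin.ext (by omega)
    · intro i
      simp only [sub_sub_sub_cancel_right]
      exact hs ⟨m + i, by omega⟩
    · simp
  · rintro w ⟨-, -⟩ w' ⟨-, -⟩ h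
    simp only [Prod.mk.injEq] at h
    obtain ⟨h1, h2⟩ := h
    have hm := congrFun h1 ⟨m, by omega⟩
    funext i
    by_cases hi : (i : ℕ) ≤ m
    · exact congrFun h1 ⟨i, by omega⟩
    · have h3 := congrFun h2 ⟨i - m, by omega⟩
      simp only at h3 hm
      rw [hm] at h3
      have h4 := sub_left_injective h3
      have h5 : (⟨m + (i - m), by omega⟩ : Fin (m + n + 1)) = i := Fin.ext (by simp only; omega)
      rwa [h5] at h4

/-- The limit that defines the connective constant exists. -/
theorem tendsto_connectiveConstant {d : ℕ} (hd : 1 ≤ d) :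
    Tendsto (fun N : ℕ => (sawCount d N : ℝ) ^ (1 / (N : ℝ))) atTop
      (𝓝 (connectiveConstant d)) := by
  have hpos : ∀ N, (0 : ℝ) < sawCount d N := fun N => by exact_mod_cast sawCount_pos hd N
  have hsub : Subadditive (fun N => Real.log (sawCount d N)) := by
    intro m n
    rw [← Real.log_mul (hpos m).ne' (hpos n).ne']
    exact Real.log_le_log (hpos _) (by exact_mod_cast sawCount_add_le d m n)
  have hbdd : BddBelow (Set.range fun N : ℕ => Real.log (sawCount d N) / N) := by
    refine ⟨0, ?_⟩
    rintro _ ⟨N, rfl⟩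
    exact div_nonneg (Real.log_nonneg (by exact_mod_cast sawCount_pos hd N)) (Nat.cast_nonneg N)
  have hlim := (Real.continuous_exp.tendsto _).comp (hsub.tendsto_lim hbdd)
  refine tendsto_nhds_limUnder ⟨_, hlim.congr fun N => ?_⟩
  rw [Real.rpow_def_of_pos (hpos N)]
  simp [div_eq_mul_inv]

/-! ### The Anderson Hamiltonian and its Green's function -/

/-- The random potential of the Anderson model: the `ω(x)`, `x ∈ ℤ^d`, are mutually independent
random variables, each uniformly distributed in `[-1, 1]`. -/
structure IsAndersonPotential {d : ℕ} {Ω : Type*} [MeasurableSpace Ω] (P : Measure Ω)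
    (ω : (Fin d → ℤ) → Ω → Set.Icc (-1 : ℝ) 1) : Prop where
  measurable : ∀ x, Measurable (ω x)
  indep : iIndepFun ω P
  uniform : ∀ x, pdf.IsUniform (fun o => (ω x o : ℝ)) (Set.Icc (-1 : ℝ) 1) P volume

/-- The Hilbert space `ℓ²(Λ)`. -/
abbrev EllTwo {d : ℕ} (Λ : Set (Fin d → ℤ)) : Type := lp (fun _ : Λ => ℂ) 2

theorem unitVectors_finite (d : ℕ) : {e : Fin d → ℤ | latticeNorm e = 1}.Finite := by
  refine (Set.finite_Icc (fun _ => -1) (fun _ => 1)).subset ?_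
  intro e he
  have key : ∀ j, (e j).natAbs ≤ 1 := fun j => he ▸ latticeNorm_natAbs_le e j
  constructor <;> intro j <;> have := key j <;> simp only <;> omega

theorem neighbors_finite {d : ℕ} (Λ : Set (Fin d → ℤ)) (x : Λ) :
    {x' : Λ | latticeNorm (x'.1 - x.1) = 1}.Finite :=
  Set.Finite.preimage (f := fun x' : Λ => x'.1 - x.1)
    (fun _ _ _ _ h => Subtype.ext (sub_left_injective h)) (unitVectors_finite d)

/-- The finite set of all `x' ∈ Λ` with `|x' - x| = 1`. -/
noncomputable def neighbors {d : ℕ} (Λ : Set (Fin d → ℤ)) (x : Λ) : Finset Λ :=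
  (neighbors_finite Λ x).toFinset

theorem mem_neighbors {d : ℕ} {Λ : Set (Fin d → ℤ)} {x x' : Λ} :
    x' ∈ neighbors Λ x ↔ latticeNorm (x'.1 - x.1) = 1 := by
  simp [neighbors]

theorem mem_neighbors_comm {d : ℕ} {Λ : Set (Fin d → ℤ)} {x x' : Λ} :
    x' ∈ neighbors Λ x ↔ x ∈ neighbors Λ x' := by
  rw [mem_neighbors, mem_neighbors]
  have : latticeNorm (x'.1 - x.1) = latticeNorm (x.1 - x'.1) := by
    unfold latticeNorm
    refine Finset.sum_congr rfl fun i _ => ?_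
    simp only [Pi.sub_apply]
    omega
  rw [this]

theorem card_neighbors_le {d : ℕ} (Λ : Set (Fin d → ℤ)) (x : Λ) :
    (neighbors Λ x).card ≤ (unitVectors_finite d).toFinset.card := by
  refine Finset.card_le_card_of_injOn (fun x' => x'.1 - x.1) ?_ ?_
  · intro x' hx'
    simpa using mem_neighbors.1 hx'
  · intro a _ b _ h
    exact Subtype.ext (sub_left_injective h)

/-- The expression `∑_{x' ∈ Λ, |x' - x| = 1} ψ(x') + lam ω(x) ψ(x)`. -/
noncomputable def hamiltonianFun {d : ℕ} (Λ : Set (Fin d → ℤ)) (lam : ℝ)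
    (ω : (Fin d → ℤ) → Set.Icc (-1 : ℝ) 1) (ψ : Λ → ℂ) (x : Λ) : ℂ :=
  ∑ x' ∈ neighbors Λ x, ψ x' + (lam : ℂ) * ((ω x.1 : ℝ) : ℂ) * ψ x

theorem hamiltonianFun_bound {d : ℕ} (Λ : Set (Fin d → ℤ)) (lam : ℝ)
    (ω : (Fin d → ℤ) → Set.Icc (-1 : ℝ) 1) :
    ∃ C : ℝ, 0 ≤ C ∧ ∀ (ψ : EllTwo Λ) (s : Finset Λ),
      ∑ x ∈ s, ‖hamiltonianFun Λ lam ω ψ x‖ ^ (2 : ENNReal).toReal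
        ≤ (C * ‖ψ‖) ^ (2 : ENNReal).toReal := by
  classical
  set D : ℝ := ((unitVectors_finite d).toFinset.card : ℝ) with hD
  have hD0 : 0 ≤ D := Nat.cast_nonneg _
  refine ⟨Real.sqrt (2 * D ^ 2 + 2 * lam ^ 2), Real.sqrt_nonneg _, fun ψ s => ?_⟩
  have hψ : ∀ t : Finset Λ, ∑ x ∈ t, ‖ψ x‖ ^ 2 ≤ ‖ψ‖ ^ 2 := by
    intro t
    have := lp.sum_rpow_le_norm_rpow (p := 2) (by simp) ψ t
    simpa using this
  simp only [ENNReal.toReal_ofNat, Real.rpow_ofNat]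
  rw [mul_pow, Real.sq_sqrt (by positivity)]
  have hcard : ∀ x, ((neighbors Λ x).card : ℝ) ≤ D := fun x =>
    Nat.cast_le.2 (card_neighbors_le Λ x)
  have hpt : ∀ x, ‖hamiltonianFun Λ lam ω ψ x‖ ^ 2
      ≤ 2 * D * ∑ x' ∈ neighbors Λ x, ‖ψ x'‖ ^ 2 + 2 * lam ^ 2 * ‖ψ x‖ ^ 2 := by
    intro x
    have h1 : ‖∑ x' ∈ neighbors Λ x, ψ x'‖ ^ 2 ≤ D * ∑ x' ∈ neighbors Λ x, ‖ψ x'‖ ^ 2 :=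
      calc ‖∑ x' ∈ neighbors Λ x, ψ x'‖ ^ 2 ≤ (∑ x' ∈ neighbors Λ x, ‖ψ x'‖) ^ 2 := by
            gcongr; exact norm_sum_le _ _
        _ ≤ (neighbors Λ x).card * ∑ x' ∈ neighbors Λ x, ‖ψ x'‖ ^ 2 := sq_sum_le_card_mul_sum_sq
        _ ≤ _ := by gcongr; exact hcard x
    have h2 : ‖(lam : ℂ) * ((ω x.1 : ℝ) : ℂ) * ψ x‖ ^ 2 ≤ lam ^ 2 * ‖ψ x‖ ^ 2 := by
      rw [norm_mul, norm_mul, mul_pow, mul_pow, Complex.norm_real, Complex.norm_real,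
        Real.norm_eq_abs, Real.norm_eq_abs, sq_abs, sq_abs]
      have : (ω x.1 : ℝ) ^ 2 ≤ 1 := by
        have := (ω x.1).2
        nlinarith [this.1, this.2]
      calc _ ≤ lam ^ 2 * 1 * ‖ψ x‖ ^ 2 := by gcongr
        _ = _ := by ring
    have h3 : ‖hamiltonianFun Λ lam ω ψ x‖ ^ 2 ≤ 2 * (‖∑ x' ∈ neighbors Λ x, ψ x'‖ ^ 2 +
        ‖(lam : ℂ) * ((ω x.1 : ℝ) : ℂ) * ψ x‖ ^ 2) :=
      calc _ ≤ (‖∑ x' ∈ neighbors Λ x, ψ x'‖ + ‖(lam : ℂ) * ((ω x.1 : ℝ) : ℂ) * ψ x‖) ^ 2 := by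
            gcongr; exact norm_add_le _ _
        _ ≤ _ := add_sq_le
    linarith
  have hswap : ∑ x ∈ s, ∑ x' ∈ neighbors Λ x, ‖ψ x'‖ ^ 2 ≤ D * ‖ψ‖ ^ 2 := by
    rw [Finset.sum_comm' (t' := s.biUnion (neighbors Λ))
      (s' := fun x' => s.filter (fun x => x' ∈ neighbors Λ x))
      (by
        intro x y
        simp only [Finset.mem_filter, Finset.mem_biUnion]
        constructor
        · exact fun h => ⟨h, x, h⟩
        · exact fun h => h.1)]
    calc _ ≤ ∑ x' ∈ s.biUnion (neighbors Λ), D * ‖ψ x'‖ ^ 2 := by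
          refine Finset.sum_le_sum fun x' _ => ?_
          rw [Finset.sum_const, nsmul_eq_mul]
          gcongr
          refine le_trans ?_ (hcard x')
          exact_mod_cast Finset.card_le_card fun x hx =>
            mem_neighbors_comm.1 (Finset.mem_filter.1 hx).2
      _ ≤ _ := by
          rw [← Finset.mul_sum]
          gcongr
          exact hψ _
  calc _ ≤ ∑ x ∈ s, (2 * D * ∑ x' ∈ neighbors Λ x, ‖ψ x'‖ ^ 2 + 2 * lam ^ 2 * ‖ψ x‖ ^ 2) :=
        Finset.sum_le_sum fun x _ => hpt x
    _ = 2 * D * ∑ x ∈ s, ∑ x' ∈ neighbors Λ x, ‖ψ x'‖ ^ 2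
          + 2 * lam ^ 2 * ∑ x ∈ s, ‖ψ x‖ ^ 2 := by
        rw [Finset.sum_add_distrib, Finset.mul_sum, Finset.mul_sum]
    _ ≤ 2 * D * (D * ‖ψ‖ ^ 2) + 2 * lam ^ 2 * ‖ψ‖ ^ 2 := by
        gcongr
        exact hψ s
    _ = _ := by ring

/-- The Anderson Hamiltonian `H_ω^(Λ)` restricted to `Λ`, a bounded operator on `ℓ²(Λ)`. -/
noncomputable def hamiltonian {d : ℕ} (Λ : Set (Fin d → ℤ)) (lam : ℝ)
    (ω : (Fin d → ℤ) → Set.Icc (-1 : ℝ) 1) : EllTwo Λ →L[ℂ] EllTwo Λ :=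
  LinearMap.mkContinuousOfExistsBound
    { toFun := fun ψ => ⟨hamiltonianFun Λ lam ω ψ, by
        obtain ⟨C, -, hC⟩ := hamiltonianFun_bound Λ lam ω
        exact memℓp_gen' (hC ψ)⟩
      map_add' := fun ψ φ => by
        ext x
        simp only [hamiltonianFun, lp.coeFn_add, Pi.add_apply, Finset.sum_add_distrib]
        ring
      map_smul' := fun c ψ => by
        ext x
        simp only [hamiltonianFun, lp.coeFn_smul, Pi.smul_apply, smul_eq_mul, RingHom.id_apply,
          ← Finset.mul_sum]
        ring }
    (by
      obtain ⟨C, hC0, hC⟩ := hamiltonianFun_bound Λ lam ω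
      exact ⟨C, fun ψ => lp.norm_le_of_forall_sum_le (by simp) (by positivity) (hC ψ)⟩)

open Classical in
/-- The Green's function `G_z^(Λ)(x, y) = ⟨δ_x, (H_ω^(Λ) - z)⁻¹ δ_y⟩` for `x, y ∈ Λ`, and `0` if
`x ∉ Λ` or `y ∉ Λ`. The inverse is the one in the algebra of bounded operators. -/
noncomputable def greenFunction {d : ℕ} (Λ : Set (Fin d → ℤ)) (lam : ℝ)
    (ω : (Fin d → ℤ) → Set.Icc (-1 : ℝ) 1) (z : ℂ) (x y : Fin d → ℤ) : ℂ :=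
  if h : x ∈ Λ ∧ y ∈ Λ then
    inner ℂ (lp.single 2 (⟨x, h.1⟩ : Λ) (1 : ℂ) : EllTwo Λ)
      (Ring.inverse (hamiltonian Λ lam ω - z • ContinuousLinearMap.id ℂ (EllTwo Λ))
        (lp.single 2 (⟨y, h.2⟩ : Λ) (1 : ℂ)))
  else 0

/-! ### The parameters of the theorem -/

/-- `γ(lam) = e ln(lam) / lam`. -/
noncomputable def andersonGamma (lam : ℝ) : ℝ := Real.exp 1 * Real.log lam / lam

/-- `m_ε(lam) = - ln γ(lam) - ln (μ_d + ε)`. -/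
noncomputable def decayRate (d : ℕ) (ε lam : ℝ) : ℝ :=
  -Real.log (andersonGamma lam) - Real.log (connectiveConstant d + ε)

/-- `lamAnd` is Anderson's threshold: the solution in `[e, ∞)` of `lam = μ_d e ln(lam)`. (For
`μ_d > 1` the equation has a second solution, in `(1, e)`, which is not the threshold.) -/
def IsAndersonThreshold (d : ℕ) (lamAnd : ℝ) : Prop :=
  Real.exp 1 ≤ lamAnd ∧ lamAnd = connectiveConstant d * Real.exp 1 * Real.log lamAnd

/-! ### The Hamiltonian as a self-adjoint operator -/

/-! The proof is a fractional-moment argument that removes the visited sites one at a time. For `x ∈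
Λ`, the Schur complement formula reads `(lam ω(x) - z - Σ) G^Λ(x,y) = δ_{xy} - ∑_{a ∼ x}
G^{Λ∖{x}}(a,y)` (`mul_greenFunction_eq`). The self-energy `Σ` and the right-hand side do not involve
`ω(x)`, so `ω(x)` can be averaged first. Uniformly in `ζ ∈ ℂ`, `𝔼 |lam ω(x) - ζ|^{-s} ≤ lam^{-s} /
(1 - s)` for `0 < s < 1` (`lintegral_uniform_rpow_neg_le`). The exponent `s = 1 - 1 / ln lam`
minimizes this constant, and the minimum is `γ(lam)`.

Since `t ↦ t^s` is subadditive, `𝔼 |G^Λ(x,y)|^s ≤ γ (δ_{xy} + ∑_{a ∼ x} 𝔼 |G^{Λ∖{x}}(a,y)|^s)`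
(`greenMoment_le`). A visited site has left the domain, so iteration generates exactly the
self-avoiding walks (`greenMoment_le_sum_walksIn`). After `N` steps the remainder is at most `γ^N
c_N` times a uniform bound on the moments, and it vanishes in the limit because `μ_d γ < 1`.

Exponential decay follows because a walk needs at least `|v|` steps to reach `v`
(`exists_sawCorrelation_le`). The threshold is governed by the strict decrease of `ln t / t` on `[e,
∞)` (`mul_log_lt_mul_log`). -/

theorem hamiltonian_apply {d : ℕ} (Λ : Set (Fin d → ℤ)) (lam : ℝ)
    (ω : (Fin d → ℤ) → Set.Icc (-1 : ℝ) 1) (ψ : EllTwo Λ) (x : Λ) :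
    hamiltonian Λ lam ω ψ x
      = ∑ x' ∈ neighbors Λ x, ψ x' + (lam : ℂ) * ((ω x.1 : ℝ) : ℂ) * ψ x := rfl

theorem hamiltonian_single_apply {d : ℕ} (Λ : Set (Fin d → ℤ)) (lam : ℝ)
    (ω : (Fin d → ℤ) → Set.Icc (-1 : ℝ) 1) (a b : Λ) :
    hamiltonian Λ lam ω (lp.single 2 a 1) b
      = (if a ∈ neighbors Λ b then 1 else 0)
        + (lam : ℂ) * ((ω b.1 : ℝ) : ℂ) * (if b = a then 1 else 0) := by
  rw [hamiltonian_apply]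
  simp [lp.single_apply, Pi.single_apply]

/-- The matrix in the basis of unit vectors is real and symmetric, and bounded operators on `ℓ²`
that agree on all unit vectors are equal. -/
theorem isSelfAdjoint_hamiltonian {d : ℕ} (Λ : Set (Fin d → ℤ)) (lam : ℝ)
    (ω : (Fin d → ℤ) → Set.Icc (-1 : ℝ) 1) : IsSelfAdjoint (hamiltonian Λ lam ω) := by
  classical
  rw [ContinuousLinearMap.isSelfAdjoint_iff']
  refine lp.ext_continuousLinearMap (by simp) fun a => ?_
  refine ContinuousLinearMap.ext fun c => ?_
  have hsingle : lp.single 2 a c = c • (lp.single 2 a (1 : ℂ) : EllTwo Λ) := by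
    rw [← lp.single_smul]; simp
  simp only [ContinuousLinearMap.comp_apply, lp.singleContinuousLinearMap_apply]
  rw [hsingle, map_smul, map_smul]
  congr 1
  ext b
  have h1 : (ContinuousLinearMap.adjoint (hamiltonian Λ lam ω) (lp.single 2 a (1 : ℂ))) b
      = inner ℂ (lp.single 2 b (1 : ℂ) : EllTwo Λ)
        (ContinuousLinearMap.adjoint (hamiltonian Λ lam ω) (lp.single 2 a (1 : ℂ))) := by
    rw [lp.inner_single_left]; simp
  rw [h1, ContinuousLinearMap.adjoint_inner_right, lp.inner_single_right,
    hamiltonian_single_apply, hamiltonian_single_apply]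
  simp only [mem_neighbors_comm (x := a) (x' := b)]
  by_cases hab : a = b
  · subst hab; simp
  · simp [hab, Ne.symm hab]

/-! ### The norm bound `2d + lam`. -/

theorem card_unitVectors_le (d : ℕ) : (unitVectors_finite d).toFinset.card ≤ 2 * d := by
  classical
  have hsub : (unitVectors_finite d).toFinset ⊆
      (Finset.univ : Finset (Fin d × Bool)).image
        (fun p => Pi.single p.1 (if p.2 then (1 : ℤ) else -1)) := by
    intro e he
    have he : latticeNorm e = 1 := by simpa using he
    obtain ⟨i, hi⟩ : ∃ i, e i ≠ 0 := by
      by_contra! h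
      simp [latticeNorm, h] at he
    have hsum : (e i).natAbs + ∑ j ∈ Finset.univ.erase i, (e j).natAbs = 1 := by
      rw [Finset.add_sum_erase _ (fun j => (e j).natAbs) (Finset.mem_univ i)]; exact he
    have hz : ∑ j ∈ Finset.univ.erase i, (e j).natAbs = 0 := by omega
    have hj : ∀ j, j ≠ i → e j = 0 := fun j hj => by
      have := Finset.sum_eq_zero_iff.1 hz j (by simp [hj])
      omega
    have he1 : e = Pi.single i (e i) := by
      funext j
      by_cases h : j = i
      · subst h; simp
      · simp [h, hj j h]
    rw [Finset.mem_image]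
    rcases (by omega : e i = 1 ∨ e i = -1) with h | h
    · exact ⟨(i, true), Finset.mem_univ _, by rw [he1, h]; simp⟩
    · exact ⟨(i, false), Finset.mem_univ _, by rw [he1, h]; simp⟩
  refine (Finset.card_le_card hsub).trans (Finset.card_image_le.trans ?_)
  simp [Finset.card_univ]
  omega

theorem sum_norm_sq_le {d : ℕ} {Λ : Set (Fin d → ℤ)} (ψ : EllTwo Λ) (t : Finset Λ) :
    ∑ x ∈ t, ‖ψ x‖ ^ 2 ≤ ‖ψ‖ ^ 2 := by
  have := lp.sum_rpow_le_norm_rpow (p := 2) (by simp) ψ t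
  simpa using this

/-- This is the hopping term alone. Cauchy–Schwarz at each site costs a factor `2d`, and exchanging
the sums costs another, since each site is counted at most `2d` times. Treating the potential
separately lets the norms add to exactly `2d + lam`; the constant in `hamiltonianFun_bound` is too
large for that. -/
theorem norm_hamiltonian_zero_le {d : ℕ} (Λ : Set (Fin d → ℤ))
    (ω : (Fin d → ℤ) → Set.Icc (-1 : ℝ) 1) (ψ : EllTwo Λ) :
    ‖hamiltonian Λ 0 ω ψ‖ ≤ 2 * d * ‖ψ‖ := by
  classical
  have hcard : ∀ x, ((neighbors Λ x).card : ℝ) ≤ 2 * d := fun x => by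
    exact_mod_cast (card_neighbors_le Λ x).trans (card_unitVectors_le d)
  refine lp.norm_le_of_forall_sum_le (by simp) (by positivity) fun s => ?_
  simp only [ENNReal.toReal_ofNat, Real.rpow_ofNat]
  have hpt : ∀ x, ‖hamiltonian Λ 0 ω ψ x‖ ^ 2 ≤ 2 * d * ∑ x' ∈ neighbors Λ x, ‖ψ x'‖ ^ 2 := by
    intro x
    rw [hamiltonian_apply]
    simp only [Complex.ofReal_zero, zero_mul, add_zero]
    calc ‖∑ x' ∈ neighbors Λ x, ψ x'‖ ^ 2 ≤ (∑ x' ∈ neighbors Λ x, ‖ψ x'‖) ^ 2 := by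
          gcongr; exact norm_sum_le _ _
      _ ≤ (neighbors Λ x).card * ∑ x' ∈ neighbors Λ x, ‖ψ x'‖ ^ 2 := sq_sum_le_card_mul_sum_sq
      _ ≤ _ := by gcongr; exact hcard x
  have hswap : ∑ x ∈ s, ∑ x' ∈ neighbors Λ x, ‖ψ x'‖ ^ 2 ≤ 2 * d * ‖ψ‖ ^ 2 := by
    rw [Finset.sum_comm' (t' := s.biUnion (neighbors Λ))
      (s' := fun x' => s.filter (fun x => x' ∈ neighbors Λ x))
      (by
        intro x y
        simp only [Finset.mem_filter, Finset.mem_biUnion]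
        exact ⟨fun h => ⟨h, x, h⟩, fun h => h.1⟩)]
    calc _ ≤ ∑ x' ∈ s.biUnion (neighbors Λ), 2 * d * ‖ψ x'‖ ^ 2 := by
          refine Finset.sum_le_sum fun x' _ => ?_
          rw [Finset.sum_const, nsmul_eq_mul]
          gcongr
          refine le_trans ?_ (hcard x')
          exact_mod_cast Finset.card_le_card fun x hx =>
            mem_neighbors_comm.1 (Finset.mem_filter.1 hx).2
      _ ≤ _ := by
          rw [← Finset.mul_sum]
          gcongr
          exact sum_norm_sq_le ψ _
  calc _ ≤ ∑ x ∈ s, 2 * d * ∑ x' ∈ neighbors Λ x, ‖ψ x'‖ ^ 2 :=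
        Finset.sum_le_sum fun x _ => hpt x
    _ = 2 * d * ∑ x ∈ s, ∑ x' ∈ neighbors Λ x, ‖ψ x'‖ ^ 2 := by rw [Finset.mul_sum]
    _ ≤ 2 * d * (2 * d * ‖ψ‖ ^ 2) := by gcongr
    _ = _ := by ring

theorem norm_hamiltonian_sub_le {d : ℕ} (Λ : Set (Fin d → ℤ)) {lam : ℝ} (hlam : 0 ≤ lam)
    (ω : (Fin d → ℤ) → Set.Icc (-1 : ℝ) 1) (ψ : EllTwo Λ) :
    ‖hamiltonian Λ lam ω ψ - hamiltonian Λ 0 ω ψ‖ ≤ lam * ‖ψ‖ := by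
  refine lp.norm_le_of_forall_sum_le (by simp) (by positivity) fun s => ?_
  simp only [ENNReal.toReal_ofNat, Real.rpow_ofNat, lp.coeFn_sub, Pi.sub_apply,
    hamiltonian_apply]
  calc _ ≤ ∑ x ∈ s, lam ^ 2 * ‖ψ x‖ ^ 2 := by
        refine Finset.sum_le_sum fun x _ => ?_
        have h : (ω x.1 : ℝ) ^ 2 ≤ 1 := by
          have := (ω x.1).2
          nlinarith [this.1, this.2]
        simp only [Complex.ofReal_zero, zero_mul, add_zero, add_sub_cancel_left]
        rw [norm_mul, norm_mul, mul_pow, mul_pow, Complex.norm_real, Complex.norm_real,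
          Real.norm_eq_abs, Real.norm_eq_abs, sq_abs, sq_abs]
        calc _ ≤ lam ^ 2 * 1 * ‖ψ x‖ ^ 2 := by gcongr
          _ = _ := by ring
    _ = lam ^ 2 * ∑ x ∈ s, ‖ψ x‖ ^ 2 := by rw [Finset.mul_sum]
    _ ≤ lam ^ 2 * ‖ψ‖ ^ 2 := by gcongr; exact sum_norm_sq_le ψ s
    _ = _ := by ring

theorem norm_hamiltonian_apply_le {d : ℕ} (Λ : Set (Fin d → ℤ)) {lam : ℝ} (hlam : 0 ≤ lam)
    (ω : (Fin d → ℤ) → Set.Icc (-1 : ℝ) 1) (ψ : EllTwo Λ) :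
    ‖hamiltonian Λ lam ω ψ‖ ≤ (2 * d + lam) * ‖ψ‖ := by
  have h1 := norm_hamiltonian_zero_le Λ ω ψ
  have h2 := norm_hamiltonian_sub_le Λ hlam ω ψ
  have h3 := norm_add_le (hamiltonian Λ lam ω ψ - hamiltonian Λ 0 ω ψ) (hamiltonian Λ 0 ω ψ)
  rw [sub_add_cancel] at h3
  linarith

/-! ### The resolvent off the a priori spectrum -/

/-- The operator `H_ω^(Λ) - z`. -/
noncomputable abbrev shiftedHamiltonian {d : ℕ} (Λ : Set (Fin d → ℤ)) (lam : ℝ)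
    (ω : (Fin d → ℤ) → Set.Icc (-1 : ℝ) 1) (z : ℂ) : EllTwo Λ →L[ℂ] EllTwo Λ :=
  hamiltonian Λ lam ω - z • ContinuousLinearMap.id ℂ (EllTwo Λ)

/-- `z` lies off the interval `[-2d - lam, 2d + lam]`. -/
def IsOffSpectrum (d : ℕ) (lam : ℝ) (z : ℂ) : Prop :=
  z ∉ (fun t : ℝ => (t : ℂ)) '' Set.Icc (-2 * d - lam) (2 * d + lam)

theorem IsOffSpectrum.lt_norm {d : ℕ} {lam : ℝ} {z : ℂ} (hz : IsOffSpectrum d lam z)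
    (him : z.im = 0) : 2 * d + lam < ‖z‖ := by
  by_contra! h
  have h1 := (abs_le.1 ((Complex.abs_re_le_norm z).trans h))
  exact hz ⟨z.re, ⟨by linarith [h1.1], h1.2⟩, Complex.ext (by simp) (by simp [him])⟩

/-- The spectrum of a self-adjoint operator is real and bounded by the norm. -/
theorem isUnit_shiftedHamiltonian {d : ℕ} (Λ : Set (Fin d → ℤ)) {lam : ℝ} (hlam : 0 ≤ lam)
    (ω : (Fin d → ℤ) → Set.Icc (-1 : ℝ) 1) {z : ℂ} (hz : IsOffSpectrum d lam z) :
    IsUnit (shiftedHamiltonian Λ lam ω z) := by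
  by_contra hu
  have hmem : z ∈ spectrum ℂ (hamiltonian Λ lam ω) := by
    rw [spectrum.mem_iff, IsUnit.sub_iff]
    rwa [Algebra.algebraMap_eq_smul_one]
  have him : z.im = 0 := by
    rw [(isSelfAdjoint_hamiltonian Λ lam ω).mem_spectrum_eq_re hmem]; simp
  have h1 := spectrum.norm_le_norm_mul_of_mem hmem
  have h2 : ‖hamiltonian Λ lam ω‖ ≤ 2 * d + lam :=
    ContinuousLinearMap.opNorm_le_bound _ (by positivity) (norm_hamiltonian_apply_le Λ hlam ω)
  -- Only `≤` is available: for empty `Λ` the space is zero and the identity has norm `0`.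
  have h3 : ‖(1 : EllTwo Λ →L[ℂ] EllTwo Λ)‖ ≤ 1 := ContinuousLinearMap.norm_id_le
  have h4 := hz.lt_norm him
  have : ‖hamiltonian Λ lam ω‖ * ‖(1 : EllTwo Λ →L[ℂ] EllTwo Λ)‖ ≤ (2 * d + lam) * 1 := by
    gcongr
  linarith

/-- `H_ω^(Λ) - z` is bounded below, uniformly in `Λ` and `ω`. -/
theorem exists_le_norm_shiftedHamiltonian {d : ℕ} {lam : ℝ} (hlam : 0 ≤ lam) {z : ℂ}
    (hz : IsOffSpectrum d lam z) :
    ∃ c : ℝ, 0 < c ∧ ∀ (Λ : Set (Fin d → ℤ)) (ω : (Fin d → ℤ) → Set.Icc (-1 : ℝ) 1)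
      (ψ : EllTwo Λ), c * ‖ψ‖ ≤ ‖shiftedHamiltonian Λ lam ω z ψ‖ := by
  by_cases him : z.im = 0
  -- For real `z` the constant comes from the reverse triangle inequality.
  · refine ⟨‖z‖ - (2 * d + lam), by linarith [hz.lt_norm him], fun Λ ω ψ => ?_⟩
    have h1 := norm_hamiltonian_apply_le Λ hlam ω ψ
    have h2 : ‖z • ψ‖ - ‖hamiltonian Λ lam ω ψ‖ ≤ ‖hamiltonian Λ lam ω ψ - z • ψ‖ := by
      rw [norm_sub_rev]; exact norm_sub_norm_le _ _
    rw [norm_smul] at h2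
    change _ ≤ ‖hamiltonian Λ lam ω ψ - z • ψ‖
    linarith
  · refine ⟨|z.im|, abs_pos.2 him, fun Λ ω ψ => ?_⟩
    -- As `⟨ψ, Hψ⟩` is real, `Im ⟨ψ, (H - z)ψ⟩ = -(Im z) ‖ψ‖²`; Cauchy–Schwarz then gives the
    -- constant `|Im z|`.
    have hself : (inner ℂ ψ (hamiltonian Λ lam ω ψ) : ℂ).im = 0 := by
      have h := ((ContinuousLinearMap.isSelfAdjoint_iff_isSymmetric).1
        (isSelfAdjoint_hamiltonian Λ lam ω))
      have := h.im_inner_self_apply ψ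
      simpa using this
    have h1 : |z.im| * ‖ψ‖ ^ 2 ≤ ‖ψ‖ * ‖shiftedHamiltonian Λ lam ω z ψ‖ := by
      refine le_trans ?_ (norm_inner_le_norm (𝕜 := ℂ) ψ (shiftedHamiltonian Λ lam ω z ψ))
      refine le_trans ?_ (Complex.abs_im_le_norm _)
      change _ ≤ |(inner ℂ ψ (hamiltonian Λ lam ω ψ - z • ψ) : ℂ).im|
      rw [inner_sub_right, inner_smul_right, inner_self_eq_norm_sq_to_K, Complex.sub_im, hself]
      simp [← Complex.ofReal_pow, Complex.mul_im, abs_mul]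
    rcases (norm_nonneg ψ).eq_or_lt with h0 | h0
    · rw [← h0]; simp
    · refine le_of_mul_le_mul_left ?_ h0
      nlinarith

theorem shiftedHamiltonian_inverse {d : ℕ} (Λ : Set (Fin d → ℤ)) {lam : ℝ} (hlam : 0 ≤ lam)
    (ω : (Fin d → ℤ) → Set.Icc (-1 : ℝ) 1) {z : ℂ} (hz : IsOffSpectrum d lam z)
    (φ : EllTwo Λ) :
    shiftedHamiltonian Λ lam ω z (Ring.inverse (shiftedHamiltonian Λ lam ω z) φ) = φ :=
  DFunLike.congr_fun (Ring.mul_inverse_cancel _ (isUnit_shiftedHamiltonian Λ hlam ω hz)) φ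

theorem inverse_shiftedHamiltonian {d : ℕ} (Λ : Set (Fin d → ℤ)) {lam : ℝ} (hlam : 0 ≤ lam)
    (ω : (Fin d → ℤ) → Set.Icc (-1 : ℝ) 1) {z : ℂ} (hz : IsOffSpectrum d lam z)
    (φ : EllTwo Λ) :
    Ring.inverse (shiftedHamiltonian Λ lam ω z) (shiftedHamiltonian Λ lam ω z φ) = φ :=
  DFunLike.congr_fun (Ring.inverse_mul_cancel _ (isUnit_shiftedHamiltonian Λ hlam ω hz)) φ

theorem greenFunction_eq_apply {d : ℕ} (Λ : Set (Fin d → ℤ)) (lam : ℝ)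
    (ω : (Fin d → ℤ) → Set.Icc (-1 : ℝ) 1) (z : ℂ) (x y : Λ) :
    greenFunction Λ lam ω z x y
      = Ring.inverse (shiftedHamiltonian Λ lam ω z) (lp.single 2 y (1 : ℂ)) x := by
  rw [greenFunction, dif_pos ⟨x.2, y.2⟩, lp.inner_single_left]
  simp only [Subtype.coe_eta, RCLike.inner_apply, map_one, mul_one]

theorem greenFunction_of_notMem_left {d : ℕ} {Λ : Set (Fin d → ℤ)} (lam : ℝ)
    (ω : (Fin d → ℤ) → Set.Icc (-1 : ℝ) 1) (z : ℂ) {x : Fin d → ℤ} (hx : x ∉ Λ)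
    (y : Fin d → ℤ) : greenFunction Λ lam ω z x y = 0 := by
  rw [greenFunction, dif_neg (fun h => hx h.1)]

theorem greenFunction_of_notMem_right {d : ℕ} {Λ : Set (Fin d → ℤ)} (lam : ℝ)
    (ω : (Fin d → ℤ) → Set.Icc (-1 : ℝ) 1) (z : ℂ) (x : Fin d → ℤ) {y : Fin d → ℤ}
    (hy : y ∉ Λ) : greenFunction Λ lam ω z x y = 0 := by
  rw [greenFunction, dif_neg (fun h => hy h.2)]

/-- The Green's function is bounded, uniformly in `Λ`, `ω`, and the two sites. -/
theorem exists_norm_greenFunction_le {d : ℕ} {lam : ℝ} (hlam : 0 ≤ lam) {z : ℂ}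
    (hz : IsOffSpectrum d lam z) :
    ∃ M : ℝ, 0 < M ∧ ∀ (Λ : Set (Fin d → ℤ)) (ω : (Fin d → ℤ) → Set.Icc (-1 : ℝ) 1)
      (x y : Fin d → ℤ), ‖greenFunction Λ lam ω z x y‖ ≤ M := by
  classical
  obtain ⟨c, hc, h⟩ := exists_le_norm_shiftedHamiltonian hlam hz
  refine ⟨c⁻¹, inv_pos.2 hc, fun Λ ω x y => ?_⟩
  by_cases hxy : x ∈ Λ ∧ y ∈ Λ
  · rw [greenFunction_eq_apply Λ lam ω z ⟨x, hxy.1⟩ ⟨y, hxy.2⟩]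
    refine (lp.norm_apply_le_norm (by simp) _ _).trans ?_
    have := h Λ ω (Ring.inverse (shiftedHamiltonian Λ lam ω z) (lp.single 2 ⟨y, hxy.2⟩ (1 : ℂ)))
    rw [shiftedHamiltonian_inverse Λ hlam ω hz, lp.norm_single (by simp), norm_one] at this
    rw [← one_div, le_div_iff₀ hc]
    linarith
  · rw [greenFunction, dif_neg hxy, norm_zero]
    positivity

/-! ### Continuity in the potential -/

/-- Continuity is for the product topology and a fixed `ψ`: when `Λ` is infinite, pointwise
closeness of potentials does not make the operators close in norm. Dominated convergence applies
because `|ω - ω₀| ≤ 2`. -/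
theorem continuous_hamiltonian_apply {d : ℕ} (Λ : Set (Fin d → ℤ)) (lam : ℝ) (ψ : EllTwo Λ) :
    Continuous fun ω : (Fin d → ℤ) → Set.Icc (-1 : ℝ) 1 => hamiltonian Λ lam ω ψ := by
  rw [continuous_iff_continuousAt]
  intro ω₀
  rw [ContinuousAt, tendsto_iff_norm_sub_tendsto_zero]
  have hψ : Summable fun x : Λ => ‖ψ x‖ ^ 2 := by
    have := (lp.memℓp ψ).summable (by simp)
    simpa using this
  have hlim : Tendsto (fun ω : (Fin d → ℤ) → Set.Icc (-1 : ℝ) 1 =>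
      ∑' x : Λ, (lam * ((ω x.1 : ℝ) - ω₀ x.1)) ^ 2 * ‖ψ x‖ ^ 2) (𝓝 ω₀)
      (𝓝 (∑' x : Λ, (lam * ((ω₀ x.1 : ℝ) - ω₀ x.1)) ^ 2 * ‖ψ x‖ ^ 2)) := by
    refine tendsto_tsum_of_dominated_convergence (bound := fun x => (4 * lam ^ 2) * ‖ψ x‖ ^ 2)
      (hψ.mul_left _) (fun x => ?_) (Eventually.of_forall fun ω x => ?_)
    · have : Continuous fun ω : (Fin d → ℤ) → Set.Icc (-1 : ℝ) 1 =>
          (lam * ((ω x.1 : ℝ) - ω₀ x.1)) ^ 2 * ‖ψ x‖ ^ 2 := by fun_prop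
      exact this.tendsto ω₀
    · rw [Real.norm_of_nonneg (by positivity), mul_pow]
      have : ((ω x.1 : ℝ) - ω₀ x.1) ^ 2 ≤ 4 := by
        have h1 := (ω x.1).2
        have h2 := (ω₀ x.1).2
        nlinarith [h1.1, h1.2, h2.1, h2.2]
      nlinarith [mul_le_mul_of_nonneg_left this (by positivity : 0 ≤ lam ^ 2 * ‖ψ x‖ ^ 2)]
  simp only [sub_self, mul_zero, ne_eq, OfNat.ofNat_ne_zero, not_false_eq_true, zero_pow,
    zero_mul, tsum_zero] at hlim
  have hsqrt := (Real.continuous_sqrt.tendsto 0).comp hlim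
  rw [Real.sqrt_zero] at hsqrt
  refine hsqrt.congr fun ω => ?_
  have := lp.norm_rpow_eq_tsum (p := 2) (by simp) (hamiltonian Λ lam ω ψ - hamiltonian Λ lam ω₀ ψ)
  simp only [ENNReal.toReal_ofNat, Real.rpow_ofNat] at this
  rw [← Real.sqrt_sq (norm_nonneg (hamiltonian Λ lam ω ψ - hamiltonian Λ lam ω₀ ψ)), this]
  simp only [Function.comp]
  congr 1
  refine tsum_congr fun x => ?_
  simp only [lp.coeFn_sub, Pi.sub_apply, hamiltonian_apply, add_sub_add_left_eq_sub,
    ← sub_mul, ← mul_sub, norm_mul, ← Complex.ofReal_sub, Complex.norm_real, mul_pow,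
    Real.norm_eq_abs, sq_abs]

/-- By the resolvent identity `R_ω - R_{ω₀} = (H_ω - z)⁻¹ (H_{ω₀} - H_ω) R_{ω₀}`, applied to a unit
vector, the lower bound uniform in `ω` reduces this to strong continuity of the Hamiltonian. -/
theorem continuous_greenFunction {d : ℕ} (Λ : Set (Fin d → ℤ)) {lam : ℝ} (hlam : 0 ≤ lam)
    {z : ℂ} (hz : IsOffSpectrum d lam z) (x y : Fin d → ℤ) :
    Continuous fun ω : (Fin d → ℤ) → Set.Icc (-1 : ℝ) 1 => greenFunction Λ lam ω z x y := by
  classical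
  by_cases hxy : x ∈ Λ ∧ y ∈ Λ
  swap
  · simp only [greenFunction, dif_neg hxy]; exact continuous_const
  obtain ⟨c, hc, h⟩ := exists_le_norm_shiftedHamiltonian hlam hz
  rw [continuous_iff_continuousAt]
  intro ω₀
  rw [ContinuousAt, tendsto_iff_norm_sub_tendsto_zero]
  set R : ((Fin d → ℤ) → Set.Icc (-1 : ℝ) 1) → EllTwo Λ := fun ω =>
    Ring.inverse (shiftedHamiltonian Λ lam ω z) (lp.single 2 ⟨y, hxy.2⟩ (1 : ℂ)) with hR
  have hlim : Tendsto (fun ω => c⁻¹ * ‖hamiltonian Λ lam ω₀ (R ω₀) - hamiltonian Λ lam ω (R ω₀)‖)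
      (𝓝 ω₀) (𝓝 0) := by
    have : Continuous fun ω =>
        c⁻¹ * ‖hamiltonian Λ lam ω₀ (R ω₀) - hamiltonian Λ lam ω (R ω₀)‖ :=
      continuous_const.mul (continuous_const.sub (continuous_hamiltonian_apply Λ lam _)).norm
    simpa using this.tendsto ω₀
  refine squeeze_zero (fun _ => norm_nonneg _) (fun ω => ?_) hlim
  rw [greenFunction_eq_apply Λ lam ω z ⟨x, hxy.1⟩ ⟨y, hxy.2⟩,
    greenFunction_eq_apply Λ lam ω₀ z ⟨x, hxy.1⟩ ⟨y, hxy.2⟩]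
  change ‖(R ω - R ω₀) ⟨x, hxy.1⟩‖ ≤ _
  refine (lp.norm_apply_le_norm (by simp) _ _).trans ?_
  have h1 := h Λ ω (R ω - R ω₀)
  have h2 : shiftedHamiltonian Λ lam ω z (R ω - R ω₀)
      = hamiltonian Λ lam ω₀ (R ω₀) - hamiltonian Λ lam ω (R ω₀) := by
    have e1 : shiftedHamiltonian Λ lam ω z (R ω) = shiftedHamiltonian Λ lam ω₀ z (R ω₀) := by
      rw [hR]; simp only
      rw [shiftedHamiltonian_inverse Λ hlam ω hz, shiftedHamiltonian_inverse Λ hlam ω₀ hz]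
    rw [map_sub, e1]
    simp only [shiftedHamiltonian, sub_apply]
    abel
  rw [h2] at h1
  rwa [inv_mul_eq_div, le_div_iff₀ hc, mul_comm]

/-! ### Removing one site -/

/-- The sites of `ℤ^d` at distance one from `x`. -/
noncomputable def latticeNeighbors {d : ℕ} (x : Fin d → ℤ) : Finset (Fin d → ℤ) :=
  (unitVectors_finite d).toFinset.map (addRightEmbedding x)

theorem mem_latticeNeighbors {d : ℕ} {x x' : Fin d → ℤ} :
    x' ∈ latticeNeighbors x ↔ latticeNorm (x' - x) = 1 := by
  simp only [latticeNeighbors, Finset.mem_map, Set.Finite.mem_toFinset, Set.mem_ofPred_eq,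
    addRightEmbedding_apply]
  exact ⟨fun ⟨e, he, h⟩ => by rw [← h]; simpa using he, fun h => ⟨x' - x, h, by simp⟩⟩

theorem latticeNorm_sub_comm {d : ℕ} (x y : Fin d → ℤ) :
    latticeNorm (x - y) = latticeNorm (y - x) := by
  refine Finset.sum_congr rfl fun i _ => ?_
  simp only [Pi.sub_apply]
  omega

theorem mem_latticeNeighbors_comm {d : ℕ} {x x' : Fin d → ℤ} :
    x' ∈ latticeNeighbors x ↔ x ∈ latticeNeighbors x' := by
  rw [mem_latticeNeighbors, mem_latticeNeighbors, latticeNorm_sub_comm]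

theorem notMem_latticeNeighbors_self {d : ℕ} (x : Fin d → ℤ) : x ∉ latticeNeighbors x := by
  rw [mem_latticeNeighbors]
  simp [latticeNorm]

/-- Extension by zero puts the equations on `Λ` and on `Λ ∖ {x}` over the same index set, so that
they can be subtracted. -/
theorem sum_neighbors_eq {d : ℕ} (Λ : Set (Fin d → ℤ)) (x : Λ) (f : (Fin d → ℤ) → ℂ)
    (hf : ∀ a, a ∉ Λ → f a = 0) :
    ∑ x' ∈ neighbors Λ x, f x' = ∑ a ∈ latticeNeighbors x.1, f a := by
  classical
  refine (Finset.sum_map (neighbors Λ x) (Function.Embedding.subtype (· ∈ Λ)) f).symm.trans ?_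
  refine Finset.sum_subset (fun a ha => ?_) fun a ha h => hf a fun haΛ => h ?_
  · obtain ⟨b, hb, rfl⟩ := Finset.mem_map.1 ha
    exact mem_latticeNeighbors.2 (mem_neighbors.1 hb)
  · exact Finset.mem_map.2 ⟨⟨a, haΛ⟩, mem_neighbors.2 (mem_latticeNeighbors.1 ha), rfl⟩

/-- The Green's function solves the resolvent equation. -/
theorem sum_greenFunction_add {d : ℕ} {Λ : Set (Fin d → ℤ)} {lam : ℝ} (hlam : 0 ≤ lam)
    (ω : (Fin d → ℤ) → Set.Icc (-1 : ℝ) 1) {z : ℂ} (hz : IsOffSpectrum d lam z)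
    {v : Fin d → ℤ} (hv : v ∈ Λ) (y : Fin d → ℤ) :
    ∑ a ∈ latticeNeighbors v, greenFunction Λ lam ω z a y
      + ((lam : ℂ) * ((ω v : ℝ) : ℂ) - z) * greenFunction Λ lam ω z v y
      = if v = y then (1 : ℂ) else 0 := by
  by_cases hy : y ∈ Λ
  swap
  · have hvy : v ≠ y := fun h => hy (h ▸ hv)
    simp [greenFunction_of_notMem_right lam ω z _ hy, hvy]
  have h := congrArg (fun ψ : EllTwo Λ => ψ ⟨v, hv⟩)
    (shiftedHamiltonian_inverse Λ hlam ω hz (lp.single 2 ⟨y, hy⟩ (1 : ℂ)))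
  simp only [shiftedHamiltonian, sub_apply, smul_apply,
    ContinuousLinearMap.id_apply, lp.coeFn_sub, lp.coeFn_smul, Pi.sub_apply, Pi.smul_apply,
    hamiltonian_apply, smul_eq_mul] at h
  have h1 : ∀ a : Λ, (Ring.inverse (hamiltonian Λ lam ω - z • ContinuousLinearMap.id ℂ (EllTwo Λ)))
      (lp.single 2 ⟨y, hy⟩ (1 : ℂ)) a = greenFunction Λ lam ω z a y := fun a =>
    (greenFunction_eq_apply Λ lam ω z a ⟨y, hy⟩).symm
  simp only [h1] at h
  rw [sum_neighbors_eq Λ ⟨v, hv⟩ (fun a => greenFunction Λ lam ω z a y)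
    fun a ha => greenFunction_of_notMem_left lam ω z ha y] at h
  have h2 : (lp.single 2 (⟨y, hy⟩ : Λ) (1 : ℂ) : EllTwo Λ) ⟨v, hv⟩ = if v = y then 1 else 0 := by
    simp [lp.single_apply, Pi.single_apply]
  rw [h2] at h
  rw [← h]
  ring

/-- The resolvent equation has no other square summable solution. -/
theorem eq_zero_of_resolvent_equation {d : ℕ} {Λ : Set (Fin d → ℤ)} {lam : ℝ} (hlam : 0 ≤ lam)
    (ω : (Fin d → ℤ) → Set.Icc (-1 : ℝ) 1) {z : ℂ} (hz : IsOffSpectrum d lam z)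
    (f : (Fin d → ℤ) → ℂ) (hf : ∀ a, a ∉ Λ → f a = 0) (hmem : Memℓp (fun a : Λ => f a) 2)
    (heq : ∀ v ∈ Λ, ∑ a ∈ latticeNeighbors v, f a
      + ((lam : ℂ) * ((ω v : ℝ) : ℂ) - z) * f v = 0) (v : Fin d → ℤ) : f v = 0 := by
  by_cases hv : v ∈ Λ
  swap
  · exact hf v hv
  let ψ : EllTwo Λ := ⟨fun a : Λ => f a, hmem⟩
  have hψ : ∀ a, ψ a = f a := fun a => rfl
  have h0 : shiftedHamiltonian Λ lam ω z ψ = 0 := by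
    ext u
    simp only [shiftedHamiltonian, sub_apply, smul_apply,
      ContinuousLinearMap.id_apply, lp.coeFn_sub, lp.coeFn_smul, Pi.sub_apply, Pi.smul_apply,
      hamiltonian_apply, smul_eq_mul, hψ, lp.coeFn_zero, Pi.zero_apply]
    rw [sum_neighbors_eq Λ u f hf, ← heq u u.2]
    ring
  have h1 := inverse_shiftedHamiltonian Λ hlam ω hz ψ
  rw [h0, map_zero] at h1
  rw [← hψ ⟨v, hv⟩, ← h1]
  rfl

/-- The second domain is there because columns for `Λ` are compared with columns for `Λ ∖ {x}`
inside `ℓ²(Λ ∖ {x})`. -/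
theorem memℓp_greenFunction {d : ℕ} (Λ Λ' : Set (Fin d → ℤ)) (lam : ℝ)
    (ω : (Fin d → ℤ) → Set.Icc (-1 : ℝ) 1) (z : ℂ) (y : Fin d → ℤ) :
    Memℓp (fun a : Λ' => greenFunction Λ lam ω z a y) 2 := by
  by_cases hy : y ∈ Λ
  swap
  · simp only [greenFunction_of_notMem_right lam ω z _ hy]
    exact zero_memℓp
  have h1 := (lp.memℓp (Ring.inverse (shiftedHamiltonian Λ lam ω z)
    (lp.single 2 ⟨y, hy⟩ (1 : ℂ)))).summable (by simp)
  simp only [← greenFunction_eq_apply Λ lam ω z _ ⟨y, hy⟩] at h1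
  have h2 : Summable fun a : Fin d → ℤ =>
      ‖greenFunction Λ lam ω z a y‖ ^ (2 : ENNReal).toReal := by
    rw [← (Subtype.val_injective (p := (· ∈ Λ))).summable_iff]
    · exact h1
    · intro a ha
      have ha : a ∉ Λ := by simpa using ha
      rw [greenFunction_of_notMem_left lam ω z ha]
      simp
  exact memℓp_gen (h2.comp_injective Subtype.val_injective)

/-- The self-energy `∑_{x', x'' ∼ x} G_z^(Λ ∖ {x})(x', x'')` of the site `x`. -/
noncomputable def selfEnergy {d : ℕ} (Λ : Set (Fin d → ℤ)) (lam : ℝ)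
    (ω : (Fin d → ℤ) → Set.Icc (-1 : ℝ) 1) (z : ℂ) (x : Fin d → ℤ) : ℂ :=
  ∑ a ∈ latticeNeighbors x, ∑ b ∈ latticeNeighbors x, greenFunction (Λ \ {x}) lam ω z a b

/-- The Green's function of `Λ` in terms of the one of `Λ ∖ {x}`. -/
theorem greenFunction_eq_diff_singleton {d : ℕ} {Λ : Set (Fin d → ℤ)} {lam : ℝ} (hlam : 0 ≤ lam)
    (ω : (Fin d → ℤ) → Set.Icc (-1 : ℝ) 1) {z : ℂ} (hz : IsOffSpectrum d lam z)
    (x y : Fin d → ℤ) {v : Fin d → ℤ} (hv : v ≠ x) :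
    greenFunction Λ lam ω z v y = greenFunction (Λ \ {x}) lam ω z v y
      - greenFunction Λ lam ω z x y
        * ∑ b ∈ latticeNeighbors x, greenFunction (Λ \ {x}) lam ω z v b := by
  classical
  set g : (Fin d → ℤ) → ℂ := fun a => greenFunction Λ lam ω z a y with hg
  -- `f` is the difference of the two sides, with the value of `g` at `x` deleted so that `f` is
  -- supported in `Λ ∖ {x}`. It is shown to solve the homogeneous resolvent equation there.
  set f : (Fin d → ℤ) → ℂ := fun a => (g a - if a = x then g x else 0)
    - greenFunction (Λ \ {x}) lam ω z a y
    + g x * ∑ b ∈ latticeNeighbors x, greenFunction (Λ \ {x}) lam ω z a b with hf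
  have key : f v = 0 := by
    refine eq_zero_of_resolvent_equation (Λ := Λ \ {x}) hlam ω hz f ?_ ?_ ?_ v
    · intro a ha
      have h1 : g a - (if a = x then g x else 0) = 0 := by
        by_cases hax : a = x
        · simp [hax]
        · have : a ∉ Λ := fun h => ha ⟨h, hax⟩
          simp [hax, hg, greenFunction_of_notMem_left lam ω z this]
      simp [hf, h1, greenFunction_of_notMem_left lam ω z ha]
    · have h1 : Memℓp (fun a : ↑(Λ \ {x}) => g a - if a.1 = x then g x else 0) 2 := by
        have h2 := memℓp_greenFunction Λ (Λ \ {x}) lam ω z y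
        refine (congrArg (fun F => Memℓp F 2) (funext fun a => ?_)).mp h2
        have : a.1 ≠ x := fun h => a.2.2 h
        simp [this, hg]
      refine (h1.sub (memℓp_greenFunction _ _ lam ω z y)).add ?_
      refine Memℓp.const_mul ?_ (g x)
      exact Memℓp.finsetSum _ fun b _ => memℓp_greenFunction _ _ lam ω z b
    · rintro u ⟨huΛ, hux⟩
      have hux : u ≠ x := hux
      have e1 := sum_greenFunction_add hlam ω hz huΛ y
      have e2 := sum_greenFunction_add (Λ := Λ \ {x}) hlam ω hz ⟨huΛ, hux⟩ y
      have e3 : ∑ b ∈ latticeNeighbors x, (∑ a ∈ latticeNeighbors u,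
          greenFunction (Λ \ {x}) lam ω z a b + ((lam : ℂ) * ((ω u : ℝ) : ℂ) - z)
            * greenFunction (Λ \ {x}) lam ω z u b)
          = if u ∈ latticeNeighbors x then 1 else 0 := by
        rw [Finset.sum_congr rfl fun b _ =>
          sum_greenFunction_add (Λ := Λ \ {x}) hlam ω hz ⟨huΛ, hux⟩ b]
        simp
      rw [Finset.sum_add_distrib, Finset.sum_comm, ← Finset.mul_sum] at e3
      -- Deleting the value at `x` leaves the defect `g x` at the neighbors of `x`; the sources in
      -- `e3`, multiplied by `g x`, cancel it.
      have e4 : ∑ a ∈ latticeNeighbors u, (if a = x then g x else 0)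
          = g x * if u ∈ latticeNeighbors x then 1 else 0 := by
        rw [Finset.sum_ite_eq']
        simp only [mem_latticeNeighbors_comm (x := x) (x' := u)]
        split_ifs <;> simp
      simp only [hf, Finset.sum_add_distrib, Finset.sum_sub_distrib, e4, if_neg hux,
        ← Finset.mul_sum]
      simp only [hg] at e1 ⊢
      linear_combination e1 - e2 + g x * e3
  simp only [hf, if_neg hv] at key
  linear_combination key

/-- This is the equation at `x` with the neighboring values expressed through `Λ ∖ {x}`. Apart from
`G(x,y)` itself, the only place where `ω x` enters is the explicit affine factor. -/
theorem mul_greenFunction_eq {d : ℕ} {Λ : Set (Fin d → ℤ)} {lam : ℝ} (hlam : 0 ≤ lam)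
    (ω : (Fin d → ℤ) → Set.Icc (-1 : ℝ) 1) {z : ℂ} (hz : IsOffSpectrum d lam z)
    {x : Fin d → ℤ} (hx : x ∈ Λ) (y : Fin d → ℤ) :
    ((lam : ℂ) * ((ω x : ℝ) : ℂ) - (z + selfEnergy Λ lam ω z x)) * greenFunction Λ lam ω z x y
      = (if x = y then (1 : ℂ) else 0)
        - ∑ a ∈ latticeNeighbors x, greenFunction (Λ \ {x}) lam ω z a y := by
  have e1 := sum_greenFunction_add hlam ω hz hx y
  rw [Finset.sum_congr rfl fun a ha => greenFunction_eq_diff_singleton hlam ω hz x y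
    (v := a) (by rintro rfl; exact notMem_latticeNeighbors_self _ ha),
    Finset.sum_sub_distrib, ← Finset.mul_sum] at e1
  rw [selfEnergy]
  linear_combination e1

/-- For `y = x` the right-hand side of the Schur formula is `1`, because `x ∉ Λ ∖ {x}`. -/
theorem sub_selfEnergy_ne_zero {d : ℕ} {Λ : Set (Fin d → ℤ)} {lam : ℝ} (hlam : 0 ≤ lam)
    (ω : (Fin d → ℤ) → Set.Icc (-1 : ℝ) 1) {z : ℂ} (hz : IsOffSpectrum d lam z)
    {x : Fin d → ℤ} (hx : x ∈ Λ) :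
    (lam : ℂ) * ((ω x : ℝ) : ℂ) - (z + selfEnergy Λ lam ω z x) ≠ 0 := by
  intro h
  have := mul_greenFunction_eq hlam ω hz hx x
  rw [h, zero_mul] at this
  simp [greenFunction_of_notMem_right (Λ := Λ \ {x}) lam ω z _ (fun h => h.2 rfl)] at this

/-- The Green's function of `Λ` depends only on the potential in `Λ`. -/
theorem greenFunction_congr {d : ℕ} {Λ : Set (Fin d → ℤ)} (lam : ℝ)
    {ω ω' : (Fin d → ℤ) → Set.Icc (-1 : ℝ) 1} (h : ∀ a ∈ Λ, ω a = ω' a) (z : ℂ)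
    (x y : Fin d → ℤ) : greenFunction Λ lam ω z x y = greenFunction Λ lam ω' z x y := by
  have : hamiltonian Λ lam ω = hamiltonian Λ lam ω' := by
    ext ψ v
    rw [hamiltonian_apply, hamiltonian_apply, h v v.2]
  simp only [greenFunction, this]

/-! ### The single-site bound -/

theorem lintegral_Ioc_rpow_neg {s : ℝ} (hs1 : s < 1) :
    ∫⁻ u in Set.Ioc (0 : ℝ) 1, ‖u‖ₑ ^ (-s) = ENNReal.ofReal (1 / (1 - s)) := by
  have hint : IntegrableOn (fun u : ℝ => u ^ (-s)) (Set.Ioc 0 1) volume := by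
    have := intervalIntegral.intervalIntegrable_rpow' (a := 0) (b := 1) (r := -s) (by linarith)
    rwa [intervalIntegrable_iff_integrableOn_Ioc_of_le zero_le_one] at this
  have hval : ∫ u in Set.Ioc (0 : ℝ) 1, u ^ (-s) = 1 / (1 - s) := by
    rw [← intervalIntegral.integral_of_le zero_le_one, integral_rpow (Or.inl (by linarith)),
      Real.one_rpow, Real.zero_rpow (by linarith)]
    ring
  rw [← hval, ofReal_integral_eq_lintegral_ofReal hint]
  · refine setLIntegral_congr_fun measurableSet_Ioc fun u hu => ?_
    rw [Real.enorm_eq_ofReal hu.1.le, ENNReal.ofReal_rpow_of_pos hu.1]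
  · exact (ae_restrict_iff' measurableSet_Ioc).2
      (Eventually.of_forall fun u hu => Real.rpow_nonneg hu.1.le _)

theorem lintegral_Icc_rpow_neg {s : ℝ} (hs1 : s < 1) :
    ∫⁻ u in Set.Icc (-1 : ℝ) 1, ‖u‖ₑ ^ (-s) = ENNReal.ofReal (2 / (1 - s)) := by
  have hneg : ∫⁻ u in Set.Ico (-1 : ℝ) 0, ‖u‖ₑ ^ (-s) = ENNReal.ofReal (1 / (1 - s)) := by
    rw [← lintegral_Ioc_rpow_neg hs1,
      ← (Measure.measurePreserving_neg (volume : Measure ℝ)).setLIntegral_comp_preimage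
        measurableSet_Ioc (by fun_prop)]
    simp
  have hunion : Set.Icc (-1 : ℝ) 1 =ᵐ[volume] (Set.Ico (-1 : ℝ) 0 ∪ Set.Ioc 0 1 : Set ℝ) := by
    have : Set.Icc (-1 : ℝ) 1 \ {0} = Set.Ico (-1 : ℝ) 0 ∪ Set.Ioc 0 1 := by
      ext u
      simp only [Set.mem_sdiff, Set.mem_Icc, Set.mem_singleton_iff, Set.mem_union, Set.mem_Ico,
        Set.mem_Ioc]
      constructor
      · rintro ⟨⟨h1, h2⟩, h3⟩
        rcases lt_or_gt_of_ne h3 with h | h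
        · exact Or.inl ⟨h1, h⟩
        · exact Or.inr ⟨h, h2⟩
      · rintro (⟨h1, h2⟩ | ⟨h1, h2⟩)
        · exact ⟨⟨h1, by linarith⟩, h2.ne⟩
        · exact ⟨⟨by linarith, h2⟩, h1.ne'⟩
    rw [← this]
    exact (sdiff_null_ae_eq_self (measure_singleton 0)).symm
  rw [setLIntegral_congr hunion, lintegral_union measurableSet_Ioc
    (Set.disjoint_left.2 fun u h1 h2 => absurd h1.2 (not_lt.2 h2.1.le)), hneg,
    lintegral_Ioc_rpow_neg hs1, ← ENNReal.ofReal_add (by have : 0 < 1 - s := by linarith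
                                                         positivity)
      (by have : 0 < 1 - s := by linarith
          positivity)]
  congr 1
  ring

/-- Among the translates of the interval `[-1, 1]`, the centered one has the largest integral of
`|u| ^ (-s)`. -/
theorem lintegral_Icc_sub_rpow_neg_le {s : ℝ} (hs0 : 0 < s) (hs1 : s < 1) (a : ℝ) :
    ∫⁻ t in Set.Icc (-1 : ℝ) 1, ‖t - a‖ₑ ^ (-s) ≤ ENNReal.ofReal (2 / (1 - s)) := by
  -- `h` is the excess of `|u|^{-s}` over `1` on `[-1, 1]`; outside, `|u|^{-s} ≤ 1`. Any translate
  -- therefore gives at most `2 + ∫ h`, with equality for the centered interval.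
  set h : ℝ → ENNReal := (Set.Icc (-1 : ℝ) 1).indicator fun u => ‖u‖ₑ ^ (-s) - 1 with hh
  have hmeas : Measurable h := Measurable.indicator (by fun_prop) measurableSet_Icc
  have hone : ∀ u ∈ Set.Icc (-1 : ℝ) 1, 1 ≤ ‖u‖ₑ ^ (-s) := fun u hu => by
    have hu' : ‖u‖ₑ ≤ 1 := by
      rw [Real.enorm_eq_ofReal_abs]
      exact ENNReal.ofReal_le_one.2 (abs_le.2 hu)
    rw [ENNReal.rpow_neg]
    exact ENNReal.one_le_inv.2 (ENNReal.rpow_le_one hu' hs0.le)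
  have hle : ∀ u : ℝ, ‖u‖ₑ ^ (-s) ≤ 1 + h u := by
    intro u
    by_cases hu : u ∈ Set.Icc (-1 : ℝ) 1
    · rw [hh, Set.indicator_of_mem hu]
      exact le_add_tsub
    · rw [hh, Set.indicator_of_notMem hu, add_zero, ENNReal.rpow_neg]
      refine ENNReal.inv_le_one.2 (ENNReal.one_le_rpow ?_ hs0)
      rw [Real.enorm_eq_ofReal_abs, ENNReal.one_le_ofReal]
      exact (not_le.1 fun h' => hu (abs_le.1 h')).le
  calc ∫⁻ t in Set.Icc (-1 : ℝ) 1, ‖t - a‖ₑ ^ (-s)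
      ≤ ∫⁻ t in Set.Icc (-1 : ℝ) 1, (1 + h (t - a)) := lintegral_mono fun t => hle (t - a)
    _ = volume (Set.Icc (-1 : ℝ) 1) + ∫⁻ t in Set.Icc (-1 : ℝ) 1, h (t - a) := by
        rw [lintegral_add_left measurable_const]; simp
    _ ≤ volume (Set.Icc (-1 : ℝ) 1) + ∫⁻ t, h (t - a) := by
        gcongr
        exact Measure.restrict_le_self
    _ = volume (Set.Icc (-1 : ℝ) 1) + ∫⁻ u, h u := by rw [lintegral_sub_right_eq_self]
    _ = ∫⁻ u in Set.Icc (-1 : ℝ) 1, (1 + (‖u‖ₑ ^ (-s) - 1)) := by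
        rw [lintegral_add_left measurable_const, hh, lintegral_indicator measurableSet_Icc]; simp
    _ = ∫⁻ u in Set.Icc (-1 : ℝ) 1, ‖u‖ₑ ^ (-s) :=
        setLIntegral_congr_fun measurableSet_Icc fun u hu => add_tsub_cancel_of_le (hone u hu)
    _ = _ := lintegral_Icc_rpow_neg hs1

/-- Dropping the imaginary part can only decrease the modulus, hence increase its negative power;
what remains is a real translation. At a zero of the modulus the power is `∞`, so no exceptional
point arises. -/
theorem enorm_mul_sub_rpow_neg_le {s : ℝ} (hs0 : 0 ≤ s) {lam : ℝ} (hlam : 0 < lam) (ζ : ℂ)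
    (t : ℝ) :
    ‖(lam : ℂ) * (t : ℂ) - ζ‖ₑ ^ (-s)
      ≤ ENNReal.ofReal (lam ^ (-s)) * ‖t - ζ.re / lam‖ₑ ^ (-s) := by
  have h1 : ‖lam * (t - ζ.re / lam)‖ₑ ≤ ‖(lam : ℂ) * (t : ℂ) - ζ‖ₑ := by
    rw [enorm_le_iff_norm_le]
    have : lam * (t - ζ.re / lam) = ((lam : ℂ) * (t : ℂ) - ζ).re := by
      simp only [Complex.sub_re, Complex.mul_re, Complex.ofReal_re, Complex.ofReal_im]
      field_simp
      ring
    rw [this]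
    exact Complex.abs_re_le_norm _
  have h2 : ENNReal.ofReal (lam ^ (-s)) = ‖lam‖ₑ ^ (-s) := by
    rw [Real.enorm_eq_ofReal hlam.le, ENNReal.ofReal_rpow_of_pos hlam]
  have hlam' : ‖lam‖ₑ ≠ 0 := enorm_ne_zero.2 hlam.ne'
  calc ‖(lam : ℂ) * (t : ℂ) - ζ‖ₑ ^ (-s) ≤ ‖lam * (t - ζ.re / lam)‖ₑ ^ (-s) := by
        rw [ENNReal.rpow_neg, ENNReal.rpow_neg]
        exact ENNReal.inv_le_inv.2 (ENNReal.rpow_le_rpow h1 hs0)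
    _ = _ := by
        rw [enorm_mul, h2, ENNReal.rpow_neg, ENNReal.rpow_neg, ENNReal.rpow_neg,
          ENNReal.mul_rpow_of_nonneg _ _ hs0, ENNReal.mul_inv]
        · exact Or.inl (by simp [ENNReal.rpow_eq_zero_iff, hlam'])
        · exact Or.inl (ENNReal.rpow_ne_top_of_nonneg hs0 enorm_ne_top)

/-- The a priori bound on the `s`-th moment of the diagonal Green's function, conditioned on the
potential at the other sites. -/
theorem lintegral_uniform_rpow_neg_le {s : ℝ} (hs0 : 0 < s) (hs1 : s < 1) {lam : ℝ}
    (hlam : 0 < lam) (ζ : ℂ) :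
    ∫⁻ t : ℝ, ‖(lam : ℂ) * (t : ℂ) - ζ‖ₑ ^ (-s) ∂(volume[|Set.Icc (-1 : ℝ) 1])
      ≤ ENNReal.ofReal (lam ^ (-s) / (1 - s)) := by
  have hs : 0 < 1 - s := by linarith
  have hl : 0 ≤ lam ^ (-s) := Real.rpow_nonneg hlam.le _
  rw [ProbabilityTheory.cond, lintegral_smul_measure, Real.volume_Icc, smul_eq_mul]
  calc _ ≤ (ENNReal.ofReal (1 - -1))⁻¹ * ∫⁻ t : ℝ in Set.Icc (-1 : ℝ) 1,
        ENNReal.ofReal (lam ^ (-s)) * ‖t - ζ.re / lam‖ₑ ^ (-s) := by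
        gcongr with t
        exact enorm_mul_sub_rpow_neg_le hs0.le hlam ζ t
    _ = (ENNReal.ofReal (1 - -1))⁻¹ * (ENNReal.ofReal (lam ^ (-s)) *
        ∫⁻ t : ℝ in Set.Icc (-1 : ℝ) 1, ‖t - ζ.re / lam‖ₑ ^ (-s)) := by
        rw [lintegral_const_mul _ (by fun_prop)]
    _ ≤ (ENNReal.ofReal (1 - -1))⁻¹ * (ENNReal.ofReal (lam ^ (-s)) *
        ENNReal.ofReal (2 / (1 - s))) := by
        gcongr
        exact lintegral_Icc_sub_rpow_neg_le hs0 hs1 _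
    _ = _ := by
        rw [← ENNReal.ofReal_inv_of_pos (by norm_num), ← ENNReal.ofReal_mul hl,
          ← ENNReal.ofReal_mul (by norm_num)]
        congr 1
        field_simp
        ring

/-- By independence the joint law is a product; for fixed `Y` the `X`-integral is the single-site
bound with a constant `ζ`. -/
theorem lintegral_rpow_neg_mul_le {Ω β : Type*} [MeasurableSpace Ω] [MeasurableSpace β]
    {P : Measure Ω} [IsProbabilityMeasure P] {X : Ω → ℝ} {Y : Ω → β} (hX : Measurable X)
    (hY : Measurable Y) (hXY : IndepFun X Y P)
    (hunif : pdf.IsUniform X (Set.Icc (-1 : ℝ) 1) P volume) {s : ℝ} (hs0 : 0 < s) (hs1 : s < 1)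
    {lam : ℝ} (hlam : 0 < lam) {ζ : β → ℂ} (hζ : Measurable ζ) {g : β → ENNReal}
    (hg : Measurable g) :
    ∫⁻ o, ‖(lam : ℂ) * (X o : ℂ) - ζ (Y o)‖ₑ ^ (-s) * g (Y o) ∂P
      ≤ ENNReal.ofReal (lam ^ (-s) / (1 - s)) * ∫⁻ o, g (Y o) ∂P := by
  have hF : Measurable fun p : ℝ × β => ‖(lam : ℂ) * (p.1 : ℂ) - ζ p.2‖ₑ ^ (-s) * g p.2 := by
    fun_prop
  have hlaw := (indepFun_iff_map_prod_eq_prod_map_map hX.aemeasurable hY.aemeasurable).1 hXY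
  have hu : P.map X = volume[|Set.Icc (-1 : ℝ) 1] := hunif
  have : IsProbabilityMeasure (P.map X) := Measure.isProbabilityMeasure_map hX.aemeasurable
  have : IsProbabilityMeasure (P.map Y) := Measure.isProbabilityMeasure_map hY.aemeasurable
  calc _ = ∫⁻ p : ℝ × β, ‖(lam : ℂ) * (p.1 : ℂ) - ζ p.2‖ₑ ^ (-s) * g p.2
        ∂(P.map fun o => (X o, Y o)) := by rw [lintegral_map hF (hX.prodMk hY)]
    _ = ∫⁻ b, ∫⁻ t : ℝ, ‖(lam : ℂ) * (t : ℂ) - ζ b‖ₑ ^ (-s) * g b ∂(P.map X) ∂(P.map Y) := by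
        rw [hlaw, lintegral_prod_symm _ hF.aemeasurable]
    _ ≤ ∫⁻ b, ENNReal.ofReal (lam ^ (-s) / (1 - s)) * g b ∂(P.map Y) := by
        refine lintegral_mono fun b => ?_
        simp only
        rw [lintegral_mul_const _ (by fun_prop), hu]
        gcongr
        exact lintegral_uniform_rpow_neg_le hs0 hs1 hlam (ζ b)
    _ = _ := by rw [lintegral_const_mul _ hg, lintegral_map hg hY]

/-! ### The recursion for the fractional moments -/

/-- The potential with its value at `x` replaced by zero. -/
def zeroAt {d : ℕ} (x : Fin d → ℤ) (ω : (Fin d → ℤ) → Set.Icc (-1 : ℝ) 1) :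
    (Fin d → ℤ) → Set.Icc (-1 : ℝ) 1 :=
  Function.update ω x ⟨0, by simp⟩

theorem zeroAt_of_ne {d : ℕ} {x a : Fin d → ℤ} (ω : (Fin d → ℤ) → Set.Icc (-1 : ℝ) 1)
    (h : a ≠ x) : zeroAt x ω a = ω a := Function.update_of_ne h _ _

/-- Zeroing one coordinate encodes the potential at the other sites without changing the index type.
The σ-algebras of disjoint blocks of an independent family are independent, and the constant
coordinate contributes the trivial one. -/
theorem IsAndersonPotential.indepFun_zeroAt {d : ℕ} {Ω : Type*} [MeasurableSpace Ω]
    {P : Measure Ω} {ω : (Fin d → ℤ) → Ω → Set.Icc (-1 : ℝ) 1} (hω : IsAndersonPotential P ω)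
    (x : Fin d → ℤ) :
    IndepFun (fun o => (ω x o : ℝ)) (fun o => zeroAt x (fun a => ω a o)) P := by
  have h := indep_iSup_of_disjoint (m := fun a => MeasurableSpace.comap (ω a) inferInstance)
    (fun a => (hω.measurable a).comap_le) ((iIndepFun_iff_iIndep _ _ _).1 hω.indep)
    (S := {x}) (T := {x}ᶜ) disjoint_compl_right
  have h1 : IndepFun (ω x) (fun o => zeroAt x (fun a => ω a o)) P := by
    rw [IndepFun_iff_Indep]
    refine indep_of_indep_of_le_left (indep_of_indep_of_le_right h ?_) ?_
    · rw [MeasurableSpace.pi, MeasurableSpace.comap_iSup]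
      refine iSup_le fun a => ?_
      rw [MeasurableSpace.comap_comp]
      change MeasurableSpace.comap (fun o => zeroAt x (fun a => ω a o) a) _ ≤ _
      by_cases hax : a = x
      · subst hax
        simp only [zeroAt, Function.update_self]
        rw [MeasurableSpace.comap_const]
        exact bot_le
      · simp only [zeroAt_of_ne _ hax]
        exact le_iSup₂_of_le (f := fun a (_ : a ∈ ({x}ᶜ : Set (Fin d → ℤ))) =>
          MeasurableSpace.comap (ω a) inferInstance) a hax le_rfl
    · exact le_iSup₂_of_le (f := fun a (_ : a ∈ ({x} : Set (Fin d → ℤ))) =>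
          MeasurableSpace.comap (ω a) inferInstance) x rfl le_rfl
  exact h1.comp measurable_subtype_coe measurable_id

theorem measurable_zeroAt {d : ℕ} {Ω : Type*} [MeasurableSpace Ω]
    {ω : (Fin d → ℤ) → Ω → Set.Icc (-1 : ℝ) 1} (hω : ∀ a, Measurable (ω a)) (x : Fin d → ℤ) :
    Measurable fun o => zeroAt x (fun a => ω a o) := by
  rw [measurable_pi_iff]
  intro a
  by_cases hax : a = x
  · subst hax
    simp only [zeroAt, Function.update_self]
    exact measurable_const
  · simp only [zeroAt_of_ne _ hax]
    exact hω a

/-- `ℤ^d` is countable, so the product σ-algebra contains all open sets of configurations. -/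
theorem measurable_greenFunction {d : ℕ} (Λ : Set (Fin d → ℤ)) {lam : ℝ} (hlam : 0 ≤ lam)
    {z : ℂ} (hz : IsOffSpectrum d lam z) (x y : Fin d → ℤ) :
    Measurable fun ω : (Fin d → ℤ) → Set.Icc (-1 : ℝ) 1 => greenFunction Λ lam ω z x y :=
  (continuous_greenFunction Λ hlam hz x y).measurable

theorem enorm_sum_rpow_le {ι : Type*} (S : Finset ι) (f : ι → ℂ) {s : ℝ} (hs0 : 0 < s)
    (hs1 : s ≤ 1) : ‖∑ i ∈ S, f i‖ₑ ^ s ≤ ∑ i ∈ S, ‖f i‖ₑ ^ s := by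
  classical
  induction S using Finset.induction_on with
  | empty => simp [ENNReal.zero_rpow_of_pos hs0]
  | insert i S hi ih =>
    rw [Finset.sum_insert hi, Finset.sum_insert hi]
    calc _ ≤ (‖f i‖ₑ + ‖∑ i ∈ S, f i‖ₑ) ^ s := ENNReal.rpow_le_rpow (enorm_add_le _ _) hs0.le
      _ ≤ ‖f i‖ₑ ^ s + ‖∑ i ∈ S, f i‖ₑ ^ s := ENNReal.rpow_add_le_add_rpow _ _ hs0.le hs1
      _ ≤ _ := by gcongr

/-- The fractional moment `𝔼 |G_z^(Λ)(x, y)| ^ s`. -/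
noncomputable def greenMoment {d : ℕ} {Ω : Type*} [MeasurableSpace Ω] (P : Measure Ω)
    (ω : (Fin d → ℤ) → Ω → Set.Icc (-1 : ℝ) 1) (lam : ℝ) (z : ℂ) (s : ℝ)
    (Λ : Set (Fin d → ℤ)) (x y : Fin d → ℤ) : ENNReal :=
  ∫⁻ o, ‖greenFunction Λ lam (fun a => ω a o) z x y‖ₑ ^ s ∂P

theorem greenMoment_of_notMem {d : ℕ} {Ω : Type*} [MeasurableSpace Ω] (P : Measure Ω)
    (ω : (Fin d → ℤ) → Ω → Set.Icc (-1 : ℝ) 1) (lam : ℝ) (z : ℂ) {s : ℝ} (hs0 : 0 < s)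
    {Λ : Set (Fin d → ℤ)} {x : Fin d → ℤ} (hx : x ∉ Λ) (y : Fin d → ℤ) :
    greenMoment P ω lam z s Λ x y = 0 := by
  simp [greenMoment, greenFunction_of_notMem_left lam _ z hx, ENNReal.zero_rpow_of_pos hs0]

/-- The `s`-th power of the Schur formula is averaged over `ω x` first, after its right-hand side is
split by subadditivity of `t ↦ t^s`. -/
theorem greenMoment_le {d : ℕ} {Ω : Type*} [MeasurableSpace Ω] {P : Measure Ω}
    [IsProbabilityMeasure P] {ω : (Fin d → ℤ) → Ω → Set.Icc (-1 : ℝ) 1}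
    (hω : IsAndersonPotential P ω) {lam : ℝ} (hlam : 0 < lam) {z : ℂ}
    (hz : IsOffSpectrum d lam z) {s : ℝ} (hs0 : 0 < s) (hs1 : s < 1) {Λ : Set (Fin d → ℤ)}
    {x : Fin d → ℤ} (hx : x ∈ Λ) (y : Fin d → ℤ) :
    greenMoment P ω lam z s Λ x y ≤ ENNReal.ofReal (lam ^ (-s) / (1 - s))
      * ((if x = y then 1 else 0)
        + ∑ a ∈ latticeNeighbors x, greenMoment P ω lam z s (Λ \ {x}) a y) := by
  -- Functions of the depleted domain do not see `ω x`, so they may be evaluated at the zeroed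
  -- potential, which is independent of `ω x`.
  have hG : ∀ a b ω', greenFunction (Λ \ {x}) lam ω' z a b
      = greenFunction (Λ \ {x}) lam (zeroAt x ω') z a b := fun a b ω' =>
    greenFunction_congr lam (fun v hv => (zeroAt_of_ne ω' hv.2).symm) z a b
  set ζ : ((Fin d → ℤ) → Set.Icc (-1 : ℝ) 1) → ℂ := fun ω' => z + selfEnergy Λ lam ω' z x with hζ
  set g : ((Fin d → ℤ) → Set.Icc (-1 : ℝ) 1) → ENNReal := fun ω' => (if x = y then 1 else 0)
    + ∑ a ∈ latticeNeighbors x, ‖greenFunction (Λ \ {x}) lam ω' z a y‖ₑ ^ s with hg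
  have hζmeas : Measurable ζ :=
    measurable_const.add (Finset.measurable_sum _ fun a _ => Finset.measurable_sum _ fun b _ =>
      measurable_greenFunction _ hlam.le hz a b)
  have hgreen : ∀ a, Measurable fun ω' => ‖greenFunction (Λ \ {x}) lam ω' z a y‖ₑ ^ s := fun a =>
    (measurable_greenFunction _ hlam.le hz a y).enorm.pow_const s
  have hgmeas : Measurable g :=
    measurable_const.add (Finset.measurable_sum _ fun a _ => hgreen a)
  have hζ0 : ∀ ω', ζ ω' = ζ (zeroAt x ω') := fun ω' => by
    simp only [hζ, selfEnergy, hG _ _ ω']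
  have hg0 : ∀ ω', g ω' = g (zeroAt x ω') := fun ω' => by simp only [hg, hG _ _ ω']
  have hωm : Measurable fun o => (fun a => ω a o) := measurable_pi_iff.2 hω.measurable
  calc greenMoment P ω lam z s Λ x y
      ≤ ∫⁻ o, ‖(lam : ℂ) * ((ω x o : ℝ) : ℂ) - ζ (zeroAt x fun a => ω a o)‖ₑ ^ (-s)
          * g (zeroAt x fun a => ω a o) ∂P := by
        refine lintegral_mono fun o => ?_
        simp only
        rw [← hζ0, ← hg0]
        have hne := sub_selfEnergy_ne_zero hlam.le (fun a => ω a o) hz hx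
        have heq := congrArg enorm (mul_greenFunction_eq hlam.le (fun a => ω a o) hz hx y)
        rw [enorm_mul] at heq
        have hD0 := enorm_ne_zero.2 hne
        have hrhs : ‖(if x = y then (1 : ℂ) else 0)
            - ∑ a ∈ latticeNeighbors x, greenFunction (Λ \ {x}) lam (fun a => ω a o) z a y‖ₑ ^ s
            ≤ g (fun a => ω a o) := by
          calc _ ≤ (‖(if x = y then (1 : ℂ) else 0)‖ₑ + ‖∑ a ∈ latticeNeighbors x,
                greenFunction (Λ \ {x}) lam (fun a => ω a o) z a y‖ₑ) ^ s :=
                ENNReal.rpow_le_rpow enorm_sub_le hs0.le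
            _ ≤ ‖(if x = y then (1 : ℂ) else 0)‖ₑ ^ s + ‖∑ a ∈ latticeNeighbors x,
                greenFunction (Λ \ {x}) lam (fun a => ω a o) z a y‖ₑ ^ s :=
                ENNReal.rpow_add_le_add_rpow _ _ hs0.le hs1.le
            _ ≤ _ := by
                simp only [hg]
                gcongr
                · split_ifs <;> simp [ENNReal.zero_rpow_of_pos hs0]
                · exact enorm_sum_rpow_le _ _ hs0 hs1.le
        refine le_trans (le_of_eq ?_) (mul_le_mul_right hrhs _)
        rw [← heq, ENNReal.mul_rpow_of_nonneg _ _ hs0.le, ← mul_assoc, ENNReal.rpow_neg,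
          ENNReal.inv_mul_cancel, one_mul]
        · exact (ENNReal.rpow_pos (pos_iff_ne_zero.2 hD0) enorm_ne_top).ne'
        · exact ENNReal.rpow_ne_top_of_nonneg hs0.le enorm_ne_top
    _ ≤ ENNReal.ofReal (lam ^ (-s) / (1 - s)) * ∫⁻ o, g (zeroAt x fun a => ω a o) ∂P :=
        lintegral_rpow_neg_mul_le (measurable_subtype_coe.comp (hω.measurable x))
          (measurable_zeroAt hω.measurable x) (hω.indepFun_zeroAt x) (hω.uniform x) hs0 hs1 hlam
          hζmeas hgmeas
    _ = _ := by
        rw [lintegral_congr fun o => (hg0 fun a => ω a o).symm]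
        simp only [hg]
        rw [lintegral_add_left measurable_const, lintegral_const, measure_univ, mul_one,
          lintegral_finsetSum (latticeNeighbors x) (f := fun a o =>
            ‖greenFunction (Λ \ {x}) lam (fun b => ω b o) z a y‖ₑ ^ s)
            fun a _ => (hgreen a).comp hωm]
        rfl

/-! ### Self-avoiding walks inside a domain -/

/-- The self-avoiding walks of length `n` in `Λ` that start at `x` and end in `T`. -/
def walksIn {d : ℕ} (Λ T : Set (Fin d → ℤ)) (x : Fin d → ℤ) (n : ℕ) :
    Set (Fin (n + 1) → Fin d → ℤ) :=
  {w | IsSelfAvoidingWalk w ∧ w 0 = x ∧ (∀ i, w i ∈ Λ) ∧ w (Fin.last n) ∈ T}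

theorem IsSelfAvoidingWalk.const_sub {d n : ℕ} {w : Fin (n + 1) → Fin d → ℤ}
    (hw : IsSelfAvoidingWalk w) (x : Fin d → ℤ) : IsSelfAvoidingWalk fun i => x - w i := by
  refine ⟨fun i j h => hw.1 (sub_right_injective h), fun i => ?_⟩
  refine Eq.trans ?_ (hw.2 i)
  rw [latticeNorm_sub_comm]
  congr 1
  exact sub_sub_sub_cancel_left _ _ _

theorem injective_const_sub_walk {d n : ℕ} (x : Fin d → ℤ) :
    Function.Injective fun (w : Fin (n + 1) → Fin d → ℤ) i => x - w i := fun _ _ h =>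
  funext fun i => sub_right_injective (congrFun h i)

/-- The reflection `w ↦ x - w` moves the start to the origin and an end `y` to `x - y`, the argument
of the correlation function. -/
theorem mapsTo_const_sub_walksIn {d : ℕ} (Λ T : Set (Fin d → ℤ)) (x : Fin d → ℤ) (n : ℕ) :
    Set.MapsTo (fun w i => x - w i) (walksIn Λ T x n) (sawFromZero d n) :=
  fun _ hw => ⟨hw.1.const_sub x, by simp [hw.2.1]⟩

theorem walksIn_finite {d : ℕ} (Λ T : Set (Fin d → ℤ)) (x : Fin d → ℤ) (n : ℕ) :
    (walksIn Λ T x n).Finite :=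
  Set.Finite.of_injOn (mapsTo_const_sub_walksIn Λ T x n) (injective_const_sub_walk x).injOn
    (sawFromZero_finite d n)

theorem ncard_walksIn_le_sawCount {d : ℕ} (Λ T : Set (Fin d → ℤ)) (x : Fin d → ℤ) (n : ℕ) :
    (walksIn Λ T x n).ncard ≤ sawCount d n :=
  Set.ncard_le_ncard_of_injOn _ (mapsTo_const_sub_walksIn Λ T x n)
    (injective_const_sub_walk x).injOn (sawFromZero_finite d n)

theorem sawBetween_subset {d : ℕ} (n : ℕ) (v : Fin d → ℤ) :
    sawBetween n v 0 ⊆ sawFromZero d n := fun _ hw => ⟨hw.1, hw.2.1⟩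

theorem ncard_walksIn_le_sawBetween {d : ℕ} (Λ : Set (Fin d → ℤ)) (x y : Fin d → ℤ) (n : ℕ) :
    (walksIn Λ {y} x n).ncard ≤ (sawBetween n (x - y) 0).ncard := by
  refine Set.ncard_le_ncard_of_injOn (fun w i => x - w i) (fun w hw => ?_)
    (injective_const_sub_walk x).injOn ((sawFromZero_finite d n).subset (sawBetween_subset n _))
  have h : w (Fin.last n) = y := hw.2.2.2
  exact ⟨hw.1.const_sub x, by simp [hw.2.1], by simp [h]⟩

theorem one_le_ncard_walksIn_zero {d : ℕ} {Λ T : Set (Fin d → ℤ)} {x : Fin d → ℤ} (hx : x ∈ Λ)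
    (hT : x ∈ T) : 1 ≤ (walksIn Λ T x 0).ncard := by
  refine (Set.ncard_pos (walksIn_finite Λ T x 0)).2
    ⟨fun _ => x, ⟨fun i j _ => Fin.ext (by omega), fun i => i.elim0⟩, rfl, fun _ => hx, hT⟩

/-- A walk in `Λ ∖ {x}` that starts next to `x` extends to a walk in `Λ` that starts at `x`. -/
theorem sum_ncard_walksIn_le {d : ℕ} {Λ : Set (Fin d → ℤ)} (T : Set (Fin d → ℤ))
    {x : Fin d → ℤ} (hx : x ∈ Λ) (n : ℕ) :
    ∑ a ∈ latticeNeighbors x, (walksIn (Λ \ {x}) T a n).ncard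
      ≤ (walksIn Λ T x (n + 1)).ncard := by
  classical
  simp only [Set.ncard_eq_toFinset_card _ (walksIn_finite _ _ _ _)]
  rw [← Finset.card_sigma]
  -- Prepending `x` keeps the walk self-avoiding because the rest lies in `Λ ∖ {x}`. The map is
  -- injective across different `a`, since `a` is the first site of the walk.
  refine Finset.card_le_card_of_injOn
    (fun p => Fin.cons (α := fun _ => Fin d → ℤ) x p.2) ?_ ?_
  · rintro ⟨a, w⟩ hp
    simp only [Finset.coe_sigma, Set.mem_sigma_iff, Finset.mem_coe, Set.Finite.mem_toFinset]
      at hp ⊢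
    obtain ⟨ha, ⟨hinj, hstep⟩, h0, hΛ, hT⟩ := hp
    refine ⟨⟨?_, ?_⟩, rfl, ?_, hT⟩
    · rw [Fin.cons_injective_iff]
      exact ⟨fun ⟨i, hi⟩ => (hΛ i).2 hi, hinj⟩
    · intro i
      refine Fin.cases ?_ (fun j => hstep j) i
      have : w 0 = a := h0
      simpa [this] using mem_latticeNeighbors.1 ha
    · intro i
      refine Fin.cases hx (fun j => (hΛ j).1) i
  · rintro ⟨a, w⟩ hp ⟨b, w'⟩ hp' h
    simp only [Finset.coe_sigma, Set.mem_sigma_iff, Finset.mem_coe, Set.Finite.mem_toFinset]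
      at hp hp'
    have hw : w = w' := (Fin.cons_right_injective (α := fun _ => Fin d → ℤ) x) h
    subst hw
    have hab : a = b := hp.2.2.1.symm.trans hp'.2.2.1
    subst hab
    rfl

/-- Iterating the one-step recursion `N` times. -/
theorem greenMoment_le_sum_walksIn {d : ℕ} {Ω : Type*} [MeasurableSpace Ω] {P : Measure Ω}
    [IsProbabilityMeasure P] {ω : (Fin d → ℤ) → Ω → Set.Icc (-1 : ℝ) 1}
    (hω : IsAndersonPotential P ω) {lam : ℝ} (hlam : 0 < lam) {z : ℂ}
    (hz : IsOffSpectrum d lam z) {s : ℝ} (hs0 : 0 < s) (hs1 : s < 1) (y : Fin d → ℤ)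
    {M Γ : ENNReal} (hΓ : Γ = ENNReal.ofReal (lam ^ (-s) / (1 - s)))
    (hM : ∀ Λ x, greenMoment P ω lam z s Λ x y ≤ M) (N : ℕ) (Λ : Set (Fin d → ℤ))
    (x : Fin d → ℤ) :
    greenMoment P ω lam z s Λ x y
      ≤ ∑ n ∈ Finset.range N, Γ ^ (n + 1) * ((walksIn Λ {y} x n).ncard : ENNReal)
        + Γ ^ N * ((walksIn Λ Set.univ x N).ncard : ENNReal) * M := by
  -- The domain must vary, since each step passes from `Λ` to `Λ ∖ {x}`. A completed walk of `n`
  -- steps carries a factor for each of its `n + 1` sites; in the remainder the last site is not yet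
  -- expanded, hence the power `N`.
  induction N generalizing Λ x with
  | zero =>
    by_cases hx : x ∈ Λ
    · have h1 : (1 : ENNReal) ≤ ((walksIn Λ Set.univ x 0).ncard : ENNReal) := by
        exact_mod_cast one_le_ncard_walksIn_zero hx (Set.mem_univ x)
      calc _ ≤ 1 * M := by rw [one_mul]; exact hM Λ x
        _ ≤ ((walksIn Λ Set.univ x 0).ncard : ENNReal) * M := by gcongr
        _ = _ := by simp
    · rw [greenMoment_of_notMem P ω lam z hs0 hx]; exact zero_le
  | succ N ih =>
    by_cases hx : x ∈ Λ
    swap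
    · rw [greenMoment_of_notMem P ω lam z hs0 hx]; exact zero_le
    have hcons : ∀ (T : Set (Fin d → ℤ)) n,
        ∑ a ∈ latticeNeighbors x, ((walksIn (Λ \ {x}) T a n).ncard : ENNReal)
          ≤ ((walksIn Λ T x (n + 1)).ncard : ENNReal) := fun T n => by
      exact_mod_cast sum_ncard_walksIn_le T hx n
    have hdiag : (if x = y then (1 : ENNReal) else 0) ≤ ((walksIn Λ {y} x 0).ncard : ENNReal) := by
      split_ifs with h
      · exact_mod_cast one_le_ncard_walksIn_zero hx h
      · exact zero_le
    calc _ ≤ Γ * ((if x = y then 1 else 0)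
          + ∑ a ∈ latticeNeighbors x, greenMoment P ω lam z s (Λ \ {x}) a y) := by
          rw [hΓ]; exact greenMoment_le hω hlam hz hs0 hs1 hx y
      _ ≤ Γ * (((walksIn Λ {y} x 0).ncard : ENNReal) + ∑ a ∈ latticeNeighbors x,
          (∑ n ∈ Finset.range N, Γ ^ (n + 1) * ((walksIn (Λ \ {x}) {y} a n).ncard : ENNReal)
            + Γ ^ N * ((walksIn (Λ \ {x}) Set.univ a N).ncard : ENNReal) * M)) := by
          gcongr with a
          exact ih (Λ \ {x}) a
      _ = Γ * (((walksIn Λ {y} x 0).ncard : ENNReal) +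
          (∑ n ∈ Finset.range N, Γ ^ (n + 1) *
            ∑ a ∈ latticeNeighbors x, ((walksIn (Λ \ {x}) {y} a n).ncard : ENNReal)
            + Γ ^ N * (∑ a ∈ latticeNeighbors x,
              ((walksIn (Λ \ {x}) Set.univ a N).ncard : ENNReal)) * M)) := by
          rw [Finset.sum_add_distrib, Finset.sum_comm]
          simp only [Finset.mul_sum, Finset.sum_mul]
      _ ≤ Γ * (((walksIn Λ {y} x 0).ncard : ENNReal) +
          (∑ n ∈ Finset.range N, Γ ^ (n + 1) * ((walksIn Λ {y} x (n + 1)).ncard : ENNReal)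
            + Γ ^ N * ((walksIn Λ Set.univ x (N + 1)).ncard : ENNReal) * M)) := by
          gcongr with n hn
          · exact hcons _ n
          · exact hcons _ N
      _ = _ := by
          -- The diagonal term is the walk of length `0`; the remaining terms have their length
          -- shifted by one.
          rw [Finset.sum_range_succ', mul_add, mul_add, Finset.mul_sum]
          simp only [pow_succ, pow_zero, one_mul]
          have : ∀ n, Γ * (Γ ^ n * Γ * ((walksIn Λ {y} x (n + 1)).ncard : ENNReal))
              = Γ ^ n * Γ * Γ * ((walksIn Λ {y} x (n + 1)).ncard : ENNReal) := fun n => by ring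
          simp only [this]
          ring

/-! ### Convergence of the correlation function -/

theorem one_le_connectiveConstant {d : ℕ} (hd : 1 ≤ d) : 1 ≤ connectiveConstant d :=
  ge_of_tendsto' (tendsto_connectiveConstant hd) fun N =>
    Real.one_le_rpow (by exact_mod_cast sawCount_pos hd N) (by positivity)

/-- `c_N ^ (1 / N) < r` for large `N`; the constant `A` absorbs the finitely many other terms. -/
theorem exists_sawCount_le {d : ℕ} (hd : 1 ≤ d) {r : ℝ} (hr : connectiveConstant d < r) :
    ∃ A : ℝ, 0 < A ∧ ∀ N, (sawCount d N : ℝ) ≤ A * r ^ N := by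
  have hr0 : 0 < r := by linarith [one_le_connectiveConstant hd]
  have hO : (fun N => (sawCount d N : ℝ)) =O[atTop] fun N => r ^ N := by
    refine Asymptotics.IsBigO.of_bound 1 ?_
    filter_upwards [(tendsto_connectiveConstant hd).eventually (gt_mem_nhds hr),
      eventually_ge_atTop 1] with N hN hN1
    rw [one_div] at hN
    rw [one_mul, Real.norm_of_nonneg (by positivity), Real.norm_of_nonneg (by positivity)]
    calc (sawCount d N : ℝ) = ((sawCount d N : ℝ) ^ ((N : ℝ)⁻¹)) ^ N :=
          (Real.rpow_inv_natCast_pow (by positivity) (by omega)).symm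
      _ ≤ r ^ N := by gcongr
  obtain ⟨A, hA, h⟩ := Asymptotics.bound_of_isBigO_nat_atTop hO
  refine ⟨A, hA, fun N => ?_⟩
  have := @h N (by positivity)
  rwa [Real.norm_of_nonneg (by positivity), Real.norm_of_nonneg (by positivity)] at this

theorem ncard_sawBetween_le {d : ℕ} (n : ℕ) (v : Fin d → ℤ) :
    (sawBetween n v 0).ncard ≤ sawCount d n :=
  Set.ncard_le_ncard (sawBetween_subset n v) (sawFromZero_finite d n)

theorem latticeNorm_add_le {d : ℕ} (x y : Fin d → ℤ) :
    latticeNorm (x + y) ≤ latticeNorm x + latticeNorm y := by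
  unfold latticeNorm
  rw [← Finset.sum_add_distrib]
  exact Finset.sum_le_sum fun i _ => Int.natAbs_add_le _ _

theorem latticeNorm_le_of_mem_sawBetween {d n : ℕ} {v : Fin d → ℤ}
    {w : Fin (n + 1) → Fin d → ℤ} (hw : w ∈ sawBetween n v 0) : latticeNorm v ≤ n := by
  obtain ⟨⟨-, hs⟩, h0, hlast⟩ := hw
  have key : ∀ i : Fin (n + 1), latticeNorm (w i) ≤ i := by
    intro i
    induction i using Fin.induction with
    | zero => simp [h0, latticeNorm]
    | succ i ih =>
      have h1 := latticeNorm_add_le (w i.succ - w i.castSucc) (w i.castSucc)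
      rw [sub_add_cancel, hs i] at h1
      simp only [Fin.val_succ, Fin.val_castSucc] at *
      omega
  have := key (Fin.last n)
  rwa [hlast] at this

theorem sawBetween_eq_empty {d n : ℕ} {v : Fin d → ℤ} (h : n < latticeNorm v) :
    sawBetween n v 0 = ∅ :=
  Set.eq_empty_of_forall_notMem fun _ hw => absurd (latticeNorm_le_of_mem_sawBetween hw)
    (not_le.2 h)

theorem sawCorrelationTerm_nonneg {d : ℕ} {γ : ℝ} (hγ : 0 ≤ γ) (v : Fin d → ℤ) (N : ℕ) :
    0 ≤ sawCorrelationTerm γ v N := by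
  unfold sawCorrelationTerm; positivity

theorem sawCorrelationTerm_le {d : ℕ} {γ A r : ℝ} (hγ : 0 ≤ γ)
    (hA : ∀ N, (sawCount d N : ℝ) ≤ A * r ^ N) (v : Fin d → ℤ) (N : ℕ) :
    sawCorrelationTerm γ v N ≤ A * (r * γ) ^ N := by
  have h1 : ((sawBetween N v 0).ncard : ℝ) ≤ A * r ^ N :=
    le_trans (by exact_mod_cast ncard_sawBetween_le N v) (hA N)
  calc _ ≤ γ ^ N * (A * r ^ N) := by unfold sawCorrelationTerm; gcongr
    _ = _ := by ring

theorem exists_between_connectiveConstant {d : ℕ} {γ : ℝ} (hγ : 0 < γ)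
    (hμ : connectiveConstant d * γ < 1) {ε : ℝ} (hε : 0 < ε) :
    ∃ r, connectiveConstant d < r ∧ r * γ < 1 ∧ r < connectiveConstant d + ε := by
  obtain ⟨r, h1, h2⟩ := exists_between (a₁ := connectiveConstant d)
    (a₂ := min (1 / γ) (connectiveConstant d + ε))
    (lt_min (by rwa [lt_div_iff₀ hγ]) (by linarith))
  exact ⟨r, h1, (lt_div_iff₀ hγ).1 (h2.trans_le (min_le_left _ _)),
    h2.trans_le (min_le_right _ _)⟩

theorem summable_sawCorrelationTerm {d : ℕ} (hd : 1 ≤ d) {γ : ℝ} (hγ : 0 < γ)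
    (hμ : connectiveConstant d * γ < 1) (v : Fin d → ℤ) : Summable (sawCorrelationTerm γ v) := by
  obtain ⟨r, hr, hrγ, -⟩ := exists_between_connectiveConstant hγ hμ one_pos
  obtain ⟨A, -, hA⟩ := exists_sawCount_le hd hr
  have hr0 : 0 < r := by linarith [one_le_connectiveConstant hd]
  exact Summable.of_nonneg_of_le (sawCorrelationTerm_nonneg hγ.le v)
    (sawCorrelationTerm_le hγ.le hA v)
    ((summable_geometric_of_lt_one (by positivity) hrγ).mul_left A)

theorem tendsto_pow_mul_sawCount {d : ℕ} (hd : 1 ≤ d) {γ : ℝ} (hγ : 0 < γ)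
    (hμ : connectiveConstant d * γ < 1) :
    Tendsto (fun N => γ ^ N * (sawCount d N : ℝ)) atTop (𝓝 0) := by
  obtain ⟨r, hr, hrγ, -⟩ := exists_between_connectiveConstant hγ hμ one_pos
  obtain ⟨A, -, hA⟩ := exists_sawCount_le hd hr
  have hr0 : 0 < r := by linarith [one_le_connectiveConstant hd]
  have hlim := (tendsto_pow_atTop_nhds_zero_of_lt_one (by positivity) hrγ).const_mul A
  rw [mul_zero] at hlim
  refine squeeze_zero (fun N => by positivity) (fun N => ?_) hlim
  calc _ ≤ γ ^ N * (A * r ^ N) := by gcongr; exact hA N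
    _ = _ := by ring

/-- The correlation function decays exponentially. -/
theorem exists_sawCorrelation_le {d : ℕ} (hd : 1 ≤ d) {γ : ℝ} (hγ : 0 < γ)
    (hμ : connectiveConstant d * γ < 1) {ε : ℝ} (hε : 0 < ε) :
    ∃ K : ℝ, ∀ v : Fin d → ℤ,
      sawCorrelation γ v ≤ K * (γ * (connectiveConstant d + ε)) ^ latticeNorm v := by
  -- Choosing `r < μ_d + ε` with `r γ < 1` makes the series converge even if `γ (μ_d + ε) ≥ 1`, so
  -- no smallness of `ε` is needed.
  obtain ⟨r, hr, hrγ, hrε⟩ := exists_between_connectiveConstant hγ hμ hε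
  obtain ⟨A, hA0, hA⟩ := exists_sawCount_le hd hr
  have hr0 : 0 < r := by linarith [one_le_connectiveConstant hd]
  have hq0 : 0 < r * γ := by positivity
  refine ⟨A * (1 - r * γ)⁻¹, fun v => ?_⟩
  have hsum := summable_sawCorrelationTerm hd hγ hμ v
  have hgeom := summable_geometric_of_lt_one hq0.le hrγ
  -- No walk with fewer than `|v|` steps reaches `v`, so the series starts at `N = |v|`.
  have hhead : ∑ N ∈ Finset.range (latticeNorm v), sawCorrelationTerm γ v N = 0 :=
    Finset.sum_eq_zero fun N hN => by
      simp [sawCorrelationTerm, sawBetween_eq_empty (Finset.mem_range.1 hN)]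
  calc sawCorrelation γ v = ∑' N, sawCorrelationTerm γ v (N + latticeNorm v) := by
        rw [sawCorrelation, ← hsum.sum_add_tsum_nat_add (latticeNorm v), hhead, zero_add]
    _ ≤ ∑' N, A * (r * γ) ^ latticeNorm v * (r * γ) ^ N := by
        refine ((summable_nat_add_iff _).2 hsum).tsum_le_tsum (fun N => ?_) (hgeom.mul_left _)
        refine (sawCorrelationTerm_le hγ.le hA v _).trans (le_of_eq ?_)
        rw [pow_add]; ring
    _ = A * (1 - r * γ)⁻¹ * (r * γ) ^ latticeNorm v := by
        rw [tsum_mul_left, tsum_geometric_of_lt_one hq0.le hrγ]; ring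
    _ ≤ A * (1 - r * γ)⁻¹ * (γ * (connectiveConstant d + ε)) ^ latticeNorm v := by
        have : 0 < 1 - r * γ := by linarith
        rw [mul_comm r γ] at *
        gcongr

/-! ### The fractional moment bound -/

theorem one_lt_log_of_exp_one_lt {lam : ℝ} (hlam : Real.exp 1 < lam) : 1 < Real.log lam := by
  rwa [Real.lt_log_iff_exp_lt ((Real.exp_pos 1).trans hlam)]

theorem andersonGamma_pos {lam : ℝ} (hlam : Real.exp 1 < lam) : 0 < andersonGamma lam := by
  have h0 := (Real.exp_pos 1).trans hlam
  have h1 := one_lt_log_of_exp_one_lt hlam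
  unfold andersonGamma
  positivity

/-- The iteration yields the prefactor `γ(lam)`; as `e < lam`, it may be weakened to `ln lam`. -/
theorem andersonGamma_le_log {lam : ℝ} (hlam : Real.exp 1 < lam) :
    andersonGamma lam ≤ Real.log lam := by
  have h0 := (Real.exp_pos 1).trans hlam
  have h1 := one_lt_log_of_exp_one_lt hlam
  rw [andersonGamma, div_le_iff₀ h0]
  nlinarith

/-- At the exponent `s = 1 - 1 / ln lam` the single-site bound equals `γ(lam)`. -/
theorem rpow_neg_div_eq_andersonGamma {lam : ℝ} (hlam : Real.exp 1 < lam) :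
    lam ^ (-(1 - 1 / Real.log lam)) / (1 - (1 - 1 / Real.log lam)) = andersonGamma lam := by
  have h0 := (Real.exp_pos 1).trans hlam
  have h1 : Real.log lam ≠ 0 := by linarith [one_lt_log_of_exp_one_lt hlam]
  have h2 : Real.log lam * (-(1 - 1 / Real.log lam)) = 1 - Real.log lam := by
    field_simp
    ring
  rw [Real.rpow_def_of_pos h0, h2, Real.exp_sub, Real.exp_log h0, andersonGamma]
  field_simp
  ring

theorem integrable_and_integral_le {d : ℕ} (hd : 1 ≤ d) {lam : ℝ} (hlam : Real.exp 1 < lam)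
    (hμ : connectiveConstant d * andersonGamma lam < 1) {Ω : Type*} [MeasurableSpace Ω]
    {P : Measure Ω} [IsProbabilityMeasure P] {ω : (Fin d → ℤ) → Ω → Set.Icc (-1 : ℝ) 1}
    (hω : IsAndersonPotential P ω) (Λ : Set (Fin d → ℤ)) {z : ℂ} (hz : IsOffSpectrum d lam z)
    (x y : Fin d → ℤ) :
    Integrable (fun o =>
      ‖greenFunction Λ lam (fun a => ω a o) z x y‖ ^ (1 - 1 / Real.log lam)) P ∧
    ∫ o, ‖greenFunction Λ lam (fun a => ω a o) z x y‖ ^ (1 - 1 / Real.log lam) ∂P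
      ≤ Real.log lam * sawCorrelation (andersonGamma lam) (x - y) := by
  have hlam0 := (Real.exp_pos 1).trans hlam
  have hlog := one_lt_log_of_exp_one_lt hlam
  have hγ := andersonGamma_pos hlam
  have hΓ := rpow_neg_div_eq_andersonGamma hlam
  set s : ℝ := 1 - 1 / Real.log lam with hs
  set γ := andersonGamma lam with hγdef
  have hs0 : 0 < s := by
    rw [hs, sub_pos, div_lt_one (by linarith)]
    exact hlog
  have hs1 : s < 1 := by
    have : 0 < 1 / Real.log lam := by positivity
    linarith
  -- `M` depends on `z`, but it enters only through the remainder, which tends to zero; the final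
  -- bound is therefore uniform in `z`.
  obtain ⟨M, hM0, hM⟩ := exists_norm_greenFunction_le (d := d) hlam0.le hz
  have hpow : ∀ Λ ω' a, ‖greenFunction Λ lam ω' z a y‖ ^ s ≤ M ^ s := fun Λ ω' a =>
    Real.rpow_le_rpow (norm_nonneg _) (hM Λ ω' a y) hs0.le
  have henorm : ∀ Λ ω' a, ENNReal.ofReal (‖greenFunction Λ lam ω' z a y‖ ^ s)
      = ‖greenFunction Λ lam ω' z a y‖ₑ ^ s := fun Λ ω' a => by
    rw [← ENNReal.ofReal_rpow_of_nonneg (norm_nonneg _) hs0.le, ofReal_norm]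
  have hωm : Measurable fun o => (fun a => ω a o) := measurable_pi_iff.2 hω.measurable
  have hmeas : Measurable fun o => ‖greenFunction Λ lam (fun a => ω a o) z x y‖ ^ s :=
    ((measurable_greenFunction Λ hlam0.le hz x y).comp hωm).norm.pow_const s
  refine ⟨Integrable.of_bound hmeas.aestronglyMeasurable (M ^ s)
    (Eventually.of_forall fun o => ?_), ?_⟩
  · rw [Real.norm_of_nonneg (by positivity)]
    exact hpow Λ _ x
  have hMoment : ∀ Λ a, greenMoment P ω lam z s Λ a y ≤ ENNReal.ofReal (M ^ s) := fun Λ a => by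
    calc _ ≤ ∫⁻ _, ENNReal.ofReal (M ^ s) ∂P := by
          refine lintegral_mono fun o => ?_
          simp only
          rw [← henorm]
          exact ENNReal.ofReal_le_ofReal (hpow Λ _ a)
      _ = _ := by simp
  have hint : ∫ o, ‖greenFunction Λ lam (fun a => ω a o) z x y‖ ^ s ∂P
      = (greenMoment P ω lam z s Λ x y).toReal := by
    rw [integral_eq_lintegral_of_nonneg_ae (Eventually.of_forall fun o => by positivity)
      hmeas.aestronglyMeasurable]
    simp only [henorm]
    rfl
  have hfinite : ∀ N, (greenMoment P ω lam z s Λ x y).toReal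
      ≤ γ * ∑ n ∈ Finset.range N, sawCorrelationTerm γ (x - y) n
        + γ ^ N * (sawCount d N : ℝ) * M ^ s := by
    intro N
    have h1 := greenMoment_le_sum_walksIn hω hlam0 hz hs0 hs1 y
      (Γ := ENNReal.ofReal γ) (by rw [hΓ]) hMoment N Λ x
    refine ENNReal.toReal_le_of_le_ofReal ?_ (h1.trans ?_)
    · exact add_nonneg (mul_nonneg hγ.le (Finset.sum_nonneg fun n _ =>
        sawCorrelationTerm_nonneg hγ.le _ n)) (by positivity)
    rw [ENNReal.ofReal_add (mul_nonneg hγ.le (Finset.sum_nonneg fun n _ =>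
      sawCorrelationTerm_nonneg hγ.le _ n)) (by positivity), Finset.mul_sum,
      ENNReal.ofReal_sum_of_nonneg fun n _ =>
        mul_nonneg hγ.le (sawCorrelationTerm_nonneg hγ.le _ n)]
    gcongr with n
    · rw [sawCorrelationTerm, ← mul_assoc, ENNReal.ofReal_mul (by positivity),
        ENNReal.ofReal_natCast, ← pow_succ', ENNReal.ofReal_pow hγ.le]
      exact mul_le_mul_right (by exact_mod_cast ncard_walksIn_le_sawBetween Λ x y n) _
    · rw [ENNReal.ofReal_mul (by positivity), ENNReal.ofReal_mul (by positivity),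
        ENNReal.ofReal_natCast, ENNReal.ofReal_pow hγ.le]
      gcongr
      exact ncard_walksIn_le_sawCount Λ _ x N
  have hsum := summable_sawCorrelationTerm hd hγ hμ (x - y)
  have hlim := (hsum.hasSum.tendsto_sum_nat.const_mul γ).add
    ((tendsto_pow_mul_sawCount hd hγ hμ).mul_const (M ^ s))
  rw [zero_mul, add_zero] at hlim
  rw [hint]
  refine (ge_of_tendsto' hlim hfinite).trans ?_
  have hC : 0 ≤ sawCorrelation γ (x - y) := tsum_nonneg (sawCorrelationTerm_nonneg hγ.le _)
  exact mul_le_mul_of_nonneg_right (andersonGamma_le_log hlam) hC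

/-! ### The threshold -/

/-- This is the strict decrease of `ln t / t` on `[e, ∞)`: from `ln u < u - 1` at `u = b / a`, `a
(ln b - ln a) < b - a ≤ (b - a) ln a`. -/
theorem mul_log_lt_mul_log {a b : ℝ} (ha : Real.exp 1 ≤ a) (hab : a < b) :
    a * Real.log b < b * Real.log a := by
  have ha0 : 0 < a := (Real.exp_pos 1).trans_le ha
  have hb0 : 0 < b := ha0.trans hab
  have hloga : 1 ≤ Real.log a := (Real.le_log_iff_exp_le ha0).2 ha
  have h1 : Real.log (b / a) < b / a - 1 :=
    Real.log_lt_sub_one_of_pos (by positivity)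
      (by rw [ne_eq, div_eq_one_iff_eq ha0.ne']; exact hab.ne')
  rw [Real.log_div hb0.ne' ha0.ne'] at h1
  have h2 : a * (b / a) = b := by field_simp
  have h3 := mul_lt_mul_of_pos_left h1 ha0
  nlinarith

/-- The function `t - μ_d e ln t` is nonpositive at `e` because `μ_d ≥ 1`, and nonnegative at some
large `b` because `ln t = o(t)`. Two solutions would share the same value of `ln t / t`. -/
theorem existsUnique_isAndersonThreshold {d : ℕ} (hd : 1 ≤ d) :
    ∃! lamAnd : ℝ, IsAndersonThreshold d lamAnd := by
  have hμ := one_le_connectiveConstant hd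
  have he := Real.exp_pos 1
  set μ := connectiveConstant d with hμdef
  have hex : ∃ b, Real.exp 1 ≤ b ∧ μ * Real.exp 1 * Real.log b ≤ b := by
    have ho := Real.isLittleO_log_id_atTop.bound (c := (μ * Real.exp 1)⁻¹) (by positivity)
    obtain ⟨b, hb1, hb2⟩ := (ho.and (eventually_ge_atTop (Real.exp 1))).exists
    refine ⟨b, hb2, ?_⟩
    have hb0 : 0 < b := he.trans_le hb2
    have h1 := (le_abs_self _).trans hb1
    rw [id, Real.norm_of_nonneg hb0.le, inv_mul_eq_div, le_div_iff₀ (by positivity)] at h1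
    linarith
  obtain ⟨b, hb, hfb⟩ := hex
  have hcont : ContinuousOn (fun t => t - μ * Real.exp 1 * Real.log t)
      (Set.Icc (Real.exp 1) b) := by
    refine continuousOn_id.sub (continuousOn_const.mul (Real.continuousOn_log.mono ?_))
    intro t ht
    exact (he.trans_le ht.1).ne'
  obtain ⟨t, ht, hft⟩ := intermediate_value_Icc hb hcont
    (show (0 : ℝ) ∈ Set.Icc _ _ from ⟨by simp only [Real.log_exp]; nlinarith, by linarith⟩)
  have hlt : ∀ a c, IsAndersonThreshold d a → IsAndersonThreshold d c → ¬ a < c := by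
    intro a c ha hc hac
    have h := mul_log_lt_mul_log ha.1 hac
    have h1 := ha.2
    have h2 := hc.2
    have h3 : a * Real.log c = c * Real.log a := by
      conv_lhs => rw [h1]
      conv_rhs => rw [h2]
      ring
    linarith
  have hts : IsAndersonThreshold d t := ⟨ht.1, by simp only at hft; linarith⟩
  exact ⟨t, hts, fun c hc => le_antisymm (not_lt.1 (hlt t c hts hc)) (not_lt.1 (hlt c t hc hts))⟩

theorem IsAndersonThreshold.mul_andersonGamma_lt_one {d : ℕ} {lamAnd lam : ℝ}
    (h : IsAndersonThreshold d lamAnd) (hlam : lamAnd < lam) :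
    connectiveConstant d * andersonGamma lam < 1 := by
  have ha0 : 0 < lamAnd := (Real.exp_pos 1).trans_le h.1
  have h0 : 0 < lam := ha0.trans hlam
  have hlog : 1 ≤ Real.log lamAnd := (Real.le_log_iff_exp_le ha0).2 h.1
  have h1 := mul_log_lt_mul_log h.1 hlam
  rw [andersonGamma, ← mul_div_assoc, div_lt_one h0]
  have h2 := h.2
  have h3 : lamAnd * Real.log lam
      = (connectiveConstant d * (Real.exp 1 * Real.log lam)) * Real.log lamAnd := by
    conv_lhs => rw [h2]
    ring
  rw [h3] at h1
  exact lt_of_mul_lt_mul_right h1 (by linarith)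

theorem exp_neg_decayRate_mul {d : ℕ} (hd : 1 ≤ d) {ε lam : ℝ} (hε : 0 < ε)
    (hlam : Real.exp 1 < lam) (k : ℕ) :
    Real.exp (-(decayRate d ε lam) * (k : ℝ))
      = (andersonGamma lam * (connectiveConstant d + ε)) ^ k := by
  have hγ := andersonGamma_pos hlam
  have hμ : 0 < connectiveConstant d + ε := by linarith [one_le_connectiveConstant hd]
  have : -(decayRate d ε lam) = Real.log (andersonGamma lam * (connectiveConstant d + ε)) := by
    rw [Real.log_mul hγ.ne' hμ.ne', decayRate]; ring
  rw [this, mul_comm, Real.exp_nat_mul, Real.exp_log (by positivity)]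

theorem exists_decayRate_pos {d : ℕ} (hd : 1 ≤ d) {lam : ℝ} (hlam : Real.exp 1 < lam)
    (hμ : connectiveConstant d * andersonGamma lam < 1) :
    ∃ ε₀ : ℝ, 0 < ε₀ ∧ ∀ ε : ℝ, 0 < ε → ε < ε₀ → 0 < decayRate d ε lam := by
  have hγ := andersonGamma_pos hlam
  -- The rate is positive exactly when `γ (μ_d + ε) < 1`, that is, when `ε < 1 / γ - μ_d`.
  refine ⟨1 / andersonGamma lam - connectiveConstant d, ?_, fun ε hε h => ?_⟩
  · rw [sub_pos, lt_div_iff₀ hγ]; exact hμ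
  · have hμ0 : 0 < connectiveConstant d + ε := by linarith [one_le_connectiveConstant hd]
    have h1 : (connectiveConstant d + ε) * andersonGamma lam < 1 := by
      rw [← lt_div_iff₀ hγ]; linarith
    have h2 := Real.log_neg (by positivity) h1
    rw [Real.log_mul hμ0.ne' hγ.ne'] at h2
    rw [decayRate]
    linarith

theorem theorem1 (d : ℕ) (hd : 1 ≤ d) :
    (∀ lam : ℝ, Real.exp 1 < lam → connectiveConstant d * andersonGamma lam < 1 →
      (∀ v : Fin d → ℤ, Summable (sawCorrelationTerm (andersonGamma lam) v)) ∧
      ∀ (Ω : Type*) [MeasurableSpace Ω] (P : Measure Ω) [IsProbabilityMeasure P]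
        (ω : (Fin d → ℤ) → Ω → Set.Icc (-1 : ℝ) 1), IsAndersonPotential P ω →
        ∀ (Λ : Set (Fin d → ℤ)) (z : ℂ),
          (z ∉ (fun t : ℝ => (t : ℂ)) '' Set.Icc (-2 * d - lam) (2 * d + lam)) →
          (∀ o, IsUnit (hamiltonian Λ lam (fun a => ω a o)
            - z • ContinuousLinearMap.id ℂ (EllTwo Λ))) ∧
          ∀ x y : Fin d → ℤ,
            Integrable (fun o =>
              ‖greenFunction Λ lam (fun a => ω a o) z x y‖ ^ (1 - 1 / Real.log lam)) P ∧
            ∫ o, ‖greenFunction Λ lam (fun a => ω a o) z x y‖ ^ (1 - 1 / Real.log lam) ∂P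
              ≤ Real.log lam * sawCorrelation (andersonGamma lam) (x - y)) ∧
    (∃! lamAnd : ℝ, IsAndersonThreshold d lamAnd) ∧
    (∀ lamAnd : ℝ, IsAndersonThreshold d lamAnd → ∀ lam : ℝ, lamAnd < lam →
      (∃ ε₀ : ℝ, 0 < ε₀ ∧ ∀ ε : ℝ, 0 < ε → ε < ε₀ → 0 < decayRate d ε lam) ∧
      ∀ ε : ℝ, 0 < ε → ∃ K : ℝ,
        ∀ (Ω : Type*) [MeasurableSpace Ω] (P : Measure Ω) [IsProbabilityMeasure P]
          (ω : (Fin d → ℤ) → Ω → Set.Icc (-1 : ℝ) 1), IsAndersonPotential P ω →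
          ∀ (Λ : Set (Fin d → ℤ)) (z : ℂ),
            (z ∉ (fun t : ℝ => (t : ℂ)) '' Set.Icc (-2 * d - lam) (2 * d + lam)) →
            ∀ x y : Fin d → ℤ,
              Integrable (fun o =>
                ‖greenFunction Λ lam (fun a => ω a o) z x y‖ ^ (1 - 1 / Real.log lam)) P ∧
              ∫ o, ‖greenFunction Λ lam (fun a => ω a o) z x y‖ ^ (1 - 1 / Real.log lam) ∂P
                ≤ K * Real.log lam
                  * Real.exp (-(decayRate d ε lam) * (latticeNorm (x - y) : ℝ))) := by
  refine ⟨fun lam hlam hμ => ⟨summable_sawCorrelationTerm hd (andersonGamma_pos hlam) hμ, ?_⟩,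
    existsUnique_isAndersonThreshold hd, fun lamAnd hAnd lam hlt => ?_⟩
  · intro Ω _ P _ ω hω Λ z hz
    exact ⟨fun o => isUnit_shiftedHamiltonian Λ ((Real.exp_pos 1).trans hlam).le _ hz,
      integrable_and_integral_le hd hlam hμ hω Λ hz⟩
  · have hlam : Real.exp 1 < lam := hAnd.1.trans_lt hlt
    have hμ := hAnd.mul_andersonGamma_lt_one hlt
    refine ⟨exists_decayRate_pos hd hlam hμ, fun ε hε => ?_⟩
    -- `K` is fixed before the probability space, `Λ` and `z` appear, so it depends only on `d`,
    -- `lam` and `ε`.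
    obtain ⟨K, hK⟩ := exists_sawCorrelation_le hd (andersonGamma_pos hlam) hμ hε
    refine ⟨K, fun Ω _ P _ ω hω Λ z hz x y => ?_⟩
    obtain ⟨hint, hle⟩ := integrable_and_integral_le hd hlam hμ hω Λ hz x y
    refine ⟨hint, hle.trans ?_⟩
    rw [exp_neg_decayRate_mul hd hε hlam, mul_comm K, mul_assoc]
    exact mul_le_mul_of_nonneg_left (hK (x - y))
      (zero_le_one.trans (one_lt_log_of_exp_one_lt hlam).le)
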